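/- A permutation class is a set of finite permutations that is closed downward under pattern containment, and its lower growth rate is $\liminf_{n\to\infty}\sqrt[n]{|\mathcal{C}_n|}\in[0,\infty]$, where $\mathcal{C}_n$ is the set of permutations of length $n$ in $\mathcal{C}$. An increasing oscillation is a sum indecomposable permutation that is order isomorphic to a subsequence of the sequence $4,1,6,3,8,5,\dots,2k+2,2k-1,\dots$; an oscillation is an increasing oscillation or the reverse of one. Let $\mathcal{O}$ be the class of all permutations contained in some oscillation, and let $\mathcal{W}(\mathcal{O})$ be its wreath closure, i.e. the smallest permutation class that contains $\mathcal{O}$ and contains every inflation $\sigma[\alpha_1,\dots,\alpha_m]$ of one of its members $\sigma$ (of length $m$) by nonempty members $\alpha_1,\dots,\alpha_m$. A class $\mathcal{C}$ is $\mathcal{W}(\mathcal{O})$-griddable if there are $t,u$ and a $t\times u$ matrix $\mathcal{M}$ of (possibly empty) permutation classes $\mathcal{M}_{k,\ell}\subseteq\mathcal{W}(\mathcal{O})$ such that for every $\pi\in\mathcal{C}$, of length $n$ say, there are $1=c_1\le\dots\le c_{t+1}=n+1$ and $1=r_1\le\dots\le r_{u+1}=n+1$ for which, for all $k,\ell$,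 the entries of $\pi$ with position in $[c_k,c_{k+1})$ and value in $[r_\ell,r_{\ell+1})$ are either none at all or order isomorphic to a member of $\mathcal{M}_{k,\ell}$. **Proposition.** The polynomial $1+3x+3x^2+2x^3+x^4+x^5-x^6$ has a unique positive real root $\gamma\approx 2.24409$ (that is, $|\gamma-2.24409|<5\cdot 10^{-6}$), and every permutation class with lower growth rate strictly less than $\gamma$ is $\mathcal{W}(\mathcal{O})$-griddable. -/

import Mathlib

open scoped ENNReal

namespace PermPattern

/-- A finite permutation: its length `n` together with a bijection of `{0, …, n - 1}`
(the entry in position `i` is `π.2 i`; positions and values are counted from `0`).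
The empty permutation (`n = 0`) is allowed. -/
abbrev FinPerm : Type := Σ n : ℕ, Equiv.Perm (Fin n)

/-- `σ` is the permutation that is order isomorphic to the subsequence of `π` formed by the
entries whose positions lie in `S`. -/
def IsPatternAt (σ π : FinPerm) (S : Set (Fin π.1)) : Prop :=
  ∃ f : Fin σ.1 ↪o Fin π.1, Set.range f = S ∧
    ∀ i j, σ.2 i < σ.2 j ↔ π.2 (f i) < π.2 (f j)

/-- The containment order: `σ` is order isomorphic to some subsequence of `π`. -/
def Contained (σ π : FinPerm) : Prop :=
  ∃ S : Set (Fin π.1), IsPatternAt σ π S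

/-- A permutation class is a downset for containment. -/
def IsPermClass (C : Set FinPerm) : Prop :=
  ∀ π ∈ C, ∀ σ, Contained σ π → σ ∈ C

/-- The closure of a set of permutations: everything contained in one of its members. -/
def permClosure (X : Set FinPerm) : Set FinPerm :=
  {σ | ∃ π ∈ X, Contained σ π}

/-- The number of permutations of length `n` in `C`. -/
noncomputable def speed (C : Set FinPerm) (n : ℕ) : ℕ :=
  {σ : Equiv.Perm (Fin n) | (⟨n, σ⟩ : FinPerm) ∈ C}.ncard

/-- The lower growth rate `liminf |C_n|^(1/n)`, with values in `[0, ∞]`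
(it is infinite for the class of all permutations). -/
noncomputable def lowerGrowthRate (C : Set FinPerm) : ℝ≥0∞ :=
  Filter.liminf (fun n : ℕ => (speed C n : ℝ≥0∞) ^ (1 / (n : ℝ))) Filter.atTop

/-! ### Inflations and wreath closures -/

/-- `π` is the inflation `σ[α₁, …, αₘ]`, all `αₖ` being nonempty. The map `b` sends a position
of `π` to the index of the block it belongs to: blocks follow each other from left to right,
block `k` is order isomorphic to `αₖ`, and entries in different blocks compare as the
corresponding entries of `σ`. -/
def IsInflation (π σ : FinPerm) (α : Fin σ.1 → FinPerm) : Prop :=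
  (∀ k, 0 < (α k).1) ∧
  ∃ b : Fin π.1 → Fin σ.1, Monotone b ∧
    (∀ k, IsPatternAt (α k) π {i | b i = k}) ∧
    ∀ i j, b i ≠ b j → (π.2 i < π.2 j ↔ σ.2 (b i) < σ.2 (b j))

/-- `C` contains every inflation of a member of `C` by (nonempty) members of `C`. -/
def IsWreathClosed (C : Set FinPerm) : Prop :=
  ∀ σ ∈ C, ∀ α : Fin σ.1 → FinPerm, (∀ k, α k ∈ C) → ∀ π, IsInflation π σ α → π ∈ C

/-- The wreath closure `𝓦(X)`: the smallest wreath-closed permutation class containing `X`. -/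
def wreathClosure (X : Set FinPerm) : Set FinPerm :=
  ⋂₀ {D | IsPermClass D ∧ IsWreathClosed D ∧ X ⊆ D}

/-! ### Oscillations -/

/-- `π = α ⊕ β = 12[α, β]`, with `α` and `β` nonempty. -/
def IsDirectSum (π α β : FinPerm) : Prop :=
  IsInflation π ⟨2, 1⟩ ![α, β]

/-- `π` is not the direct sum of two nonempty (hence shorter) permutations. -/
def SumIndecomposable (π : FinPerm) : Prop :=
  ¬ ∃ α β : FinPerm, IsDirectSum π α β

/-- The increasing oscillating sequence `4, 1, 6, 3, 8, 5, …, 2k + 2, 2k - 1, …`,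
indexed from `0`. -/
def oscSeq (i : ℕ) : ℕ := if Even i then i + 4 else i

/-- An increasing oscillation: a sum indecomposable permutation that is order isomorphic to a
subsequence of the increasing oscillating sequence. -/
def IsIncreasingOscillation (σ : FinPerm) : Prop :=
  SumIndecomposable σ ∧
    ∃ f : Fin σ.1 ↪o ℕ, ∀ i j, σ.2 i < σ.2 j ↔ oscSeq (f i) < oscSeq (f j)

/-- The reverse of a permutation. -/
def reverse (π : FinPerm) : FinPerm := ⟨π.1, Fin.revPerm.trans π.2⟩

/-- An oscillation: an increasing oscillation or the reverse of one. -/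
def IsOscillation (σ : FinPerm) : Prop :=
  IsIncreasingOscillation σ ∨ ∃ τ, IsIncreasingOscillation τ ∧ σ = reverse τ

/-- The class `𝓞`: the closure of the set of oscillations. -/
def oscillationClass : Set FinPerm := permClosure {σ | IsOscillation σ}

/-! ### Generalized grid classes -/

/-- The positions of the entries of `π` whose position lies in `[x₁, x₂)` and whose value lies
in `[y₁, y₂)`. -/
def cell (π : FinPerm) (x₁ x₂ y₁ y₂ : ℕ) : Set (Fin π.1) :=
  {i | x₁ ≤ (i : ℕ) ∧ (i : ℕ) < x₂ ∧ y₁ ≤ (π.2 i : ℕ) ∧ (π.2 i : ℕ) < y₂}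

/-- The column divisions `c` and row divisions `r` form an `M`-gridding of `π`, where `M` has
`t` columns and `u` rows. As positions and values are counted from `0`, the divisions run from
`0` to the length of `π`. A cell without entries is always allowed, in particular where the
entry of `M` is the empty class. -/
structure IsGridding {t u : ℕ} (M : Fin t → Fin u → Set FinPerm) (π : FinPerm)
    (c : Fin (t + 1) → ℕ) (r : Fin (u + 1) → ℕ) : Prop where
  col_mono : Monotone c
  col_first : c 0 = 0
  col_last : c (Fin.last t) = π.1
  row_mono : Monotone r
  row_first : r 0 = 0
  row_last : r (Fin.last u) = π.1
  cells : ∀ k l,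
    cell π (c k.castSucc) (c k.succ) (r l.castSucc) (r l.succ) = ∅ ∨
    ∃ σ ∈ M k l, IsPatternAt σ π (cell π (c k.castSucc) (c k.succ) (r l.castSucc) (r l.succ))

/-- `Grid(M)`: the permutations that possess an `M`-gridding. -/
def gridClass {t u : ℕ} (M : Fin t → Fin u → Set FinPerm) : Set FinPerm :=
  {π | ∃ c r, IsGridding M π c r}

/-- `C` is `D`-griddable: `C ⊆ Grid(M)` for a single finite matrix `M` of permutation classes,
each of which is a subclass of `D` (possibly empty). -/
def IsGriddable (D C : Set FinPerm) : Prop :=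
  ∃ (t u : ℕ) (M : Fin t → Fin u → Set FinPerm),
    (∀ k l, IsPermClass (M k l) ∧ M k l ⊆ D) ∧ C ⊆ gridClass M

end PermPattern

namespace PermPattern

/-! Argue by contraposition. Let `C` be a class that is not griddable, and put t = 1/γ, so that t +
t² + 2t³ + 3t⁴ + 3t⁵ + t⁶ = 1. Call a rectangle in the plot of a permutation bad if the entries in
it contain a simple permutation outside 𝓞.

From non-griddability to chains: a permutation outside 𝓦(𝓞) contains a simple permutation outside 𝓞,
since a permutation with a nontrivial interval is an inflation of smaller patterns
(`exists_isSimple_of_notMem_wreathClosure`). Hence, if a bounded number of lines cuts all bad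
rectangles of every member of `C`, these lines are a gridding with cells in 𝓦(𝓞). By a theorem of
Gyárfás and Lehel (`Rect.exists_lines`) such lines exist unless members of `C` have arbitrarily many
bad rectangles whose projections are pairwise disjoint on both axes. By Erdős–Szekeres
(`Rect.exists_chain`) there are then arbitrarily long increasing, or arbitrarily long decreasing,
sequences of bad rectangles. As 𝓞 and growth rates are invariant under reversal, they may be taken
to be increasing.

From chains to growth: every simple permutation outside 𝓞 contains a set of sum indecomposable
permutations of length at most six with ∑ t ^ length ≥ 1 (`IsSimple.rich`). Only finitely many such
sets exist, so a single one is available along increasing chains of every length, and `C` contains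
all direct sums of its members. Decomposition into sum indecomposables is unique, so the numbers sₙ
of these sums satisfy sₙ ≥ ∑ sₙ₋|τ|, whence sₙ ≥ t⁶ γⁿ (`pow_le_numSums`) and the lower growth rate
is at least γ.

Richness comes from a case analysis. A simple permutation containing 321 has enough indecomposable
patterns of length at most five. One that avoids 321 but contains 4123 contains 415263, 246135,
251364 or 351624, because simplicity forces entries that separate the 123; the case of 2341 is the
inverse of this. One that avoids 321, 4123 and 2341 is built up without any choice but the first and
lies in 𝓞. The value of γ is dictated by 251364, for which the sum is exactly 1. -/

/-! ### Occurrences and containment. -/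

/-- `f` lists the positions of an occurrence of `σ` in `π`. -/
def Occ (σ π : FinPerm) (f : Fin σ.1 → Fin π.1) : Prop :=
  StrictMono f ∧ ∀ i j, σ.2 i < σ.2 j ↔ π.2 (f i) < π.2 (f j)

lemma Occ.isPatternAt {σ π : FinPerm} {f : Fin σ.1 → Fin π.1} (h : Occ σ π f) :
    IsPatternAt σ π (Set.range f) :=
  ⟨OrderEmbedding.ofStrictMono f h.1, rfl, h.2⟩

lemma IsPatternAt.exists_occ {σ π : FinPerm} {S : Set (Fin π.1)} (h : IsPatternAt σ π S) :
    ∃ f, Occ σ π f ∧ Set.range f = S := by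
  obtain ⟨f, hf, h⟩ := h
  exact ⟨f, ⟨f.strictMono, h⟩, hf⟩

lemma contained_iff {σ π : FinPerm} : Contained σ π ↔ ∃ f, Occ σ π f := by
  constructor
  · rintro ⟨S, h⟩
    obtain ⟨f, hf, -⟩ := h.exists_occ
    exact ⟨f, hf⟩
  · rintro ⟨f, hf⟩
    exact ⟨_, hf.isPatternAt⟩

lemma Occ.contained {σ π : FinPerm} {f} (h : Occ σ π f) : Contained σ π := contained_iff.2 ⟨f, h⟩

lemma Occ.comp {σ τ π : FinPerm} {f : Fin τ.1 → Fin π.1} {g : Fin σ.1 → Fin τ.1}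
    (hf : Occ τ π f) (hg : Occ σ τ g) : Occ σ π (f ∘ g) :=
  ⟨hf.1.comp hg.1, fun i j => (hg.2 i j).trans (hf.2 _ _)⟩

/-- Values in increasing order give an occurrence. -/
lemma occ_of_strictMono {σ π : FinPerm} {f : Fin σ.1 → Fin π.1} (hf : StrictMono f)
    (hv : StrictMono fun k => π.2 (f (σ.2.symm k))) : Occ σ π f := by
  refine ⟨hf, fun i j => ?_⟩
  have := hv.lt_iff_lt (a := σ.2 i) (b := σ.2 j)
  simpa using this.symm

lemma Contained.refl (π : FinPerm) : Contained π π :=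
  Occ.contained (f := id) ⟨strictMono_id, fun _ _ => Iff.rfl⟩

lemma Contained.trans {σ τ π : FinPerm} (h : Contained σ τ) (h' : Contained τ π) :
    Contained σ π := by
  obtain ⟨g, hg⟩ := contained_iff.1 h
  obtain ⟨f, hf⟩ := contained_iff.1 h'
  exact (hf.comp hg).contained

lemma Contained.length_le {σ π : FinPerm} (h : Contained σ π) : σ.1 ≤ π.1 := by
  obtain ⟨f, hf⟩ := contained_iff.1 h
  simpa using Fintype.card_le_of_injective f hf.1.injective

/-- An injective sequence of values is order isomorphic to a permutation. -/
lemma exists_perm_of_injective {k : ℕ} {α : Type*} [LinearOrder α] (g : Fin k → α)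
    (hg : Function.Injective g) :
    ∃ σ : Equiv.Perm (Fin k), ∀ i j, σ i < σ j ↔ g i < g j := by
  refine ⟨(Tuple.sort g).symm, fun i j => ?_⟩
  have hm : StrictMono (g ∘ Tuple.sort g) :=
    (Tuple.monotone_sort g).strictMono_of_injective (hg.comp (Tuple.sort g).injective)
  have := hm.lt_iff_lt (a := (Tuple.sort g).symm i) (b := (Tuple.sort g).symm j)
  simpa using this.symm

/-- The entries in any set of positions form a pattern. -/
lemma exists_pattern (π : FinPerm) (S : Set (Fin π.1)) : ∃ σ : FinPerm, IsPatternAt σ π S := by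
  classical
  let f := S.toFinset.orderEmbOfFin rfl
  obtain ⟨σ, hσ⟩ := exists_perm_of_injective (fun i => π.2 (f i))
    (π.2.injective.comp f.injective)
  exact ⟨⟨_, σ⟩, f, by simp [f], hσ⟩

lemma IsPatternAt.card_eq {σ π : FinPerm} {S : Finset (Fin π.1)} (h : IsPatternAt σ π S) :
    σ.1 = S.card := by
  classical
  obtain ⟨f, hf, -⟩ := h
  have : S = Finset.univ.image f := by
    apply Finset.coe_injective
    rw [← hf]; simp
  rw [this, Finset.card_image_of_injective _ f.injective, Finset.card_univ, Fintype.card_fin]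

/-- Patterns on nested sets of positions are contained in each other. -/
lemma IsPatternAt.contained_of_subset {σ τ π : FinPerm} {S T : Set (Fin π.1)}
    (hσ : IsPatternAt σ π S) (hτ : IsPatternAt τ π T) (hST : S ⊆ T) : Contained σ τ := by
  obtain ⟨f, hf, hf'⟩ := hσ
  obtain ⟨g, hg, hg'⟩ := hτ
  have : ∀ i, ∃ j, g j = f i := fun i => by
    have : f i ∈ Set.range g := hg ▸ hST (hf ▸ Set.mem_range_self i)
    exact this
  choose e he using this
  refine Occ.contained (f := e) ⟨fun i j hij => ?_, fun i j => ?_⟩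
  · rw [← g.lt_iff_lt, he, he]
    exact f.lt_iff_lt.2 hij
  · rw [hf', hg', he, he]

lemma IsPatternAt.contained {σ π : FinPerm} {S : Set (Fin π.1)} (h : IsPatternAt σ π S) :
    Contained σ π := ⟨S, h⟩

/-! ### Symmetries -/

@[simp] lemma reverse_reverse (π : FinPerm) : reverse (reverse π) = π := by
  obtain ⟨n, p⟩ := π
  simp only [reverse, Sigma.mk.injEq, heq_eq_eq, true_and]
  ext i
  simp

lemma Occ.reverse {σ π : FinPerm} {f : Fin σ.1 → Fin π.1} (h : Occ σ π f) :
    Occ (reverse σ) (reverse π) (fun i : Fin σ.1 => (f i.rev).rev) := by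
  obtain ⟨n, p⟩ := π
  obtain ⟨k, s⟩ := σ
  refine ⟨fun (i j : Fin k) hij => ?_, fun (i j : Fin k) => ?_⟩
  · exact Fin.rev_lt_rev.2 (h.1 (Fin.rev_lt_rev.2 hij))
  · change s i.rev < s j.rev ↔ p (f i.rev).rev.rev < p (f j.rev).rev.rev
    rw [Fin.rev_rev, Fin.rev_rev]
    exact h.2 _ _

lemma Contained.reverse {σ π : FinPerm} (h : Contained σ π) :
    Contained (reverse σ) (reverse π) := by
  obtain ⟨f, hf⟩ := contained_iff.1 h
  exact hf.reverse.contained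

/-- The inverse permutation. -/
def inverse (π : FinPerm) : FinPerm := ⟨π.1, π.2.symm⟩

@[simp] lemma inverse_inverse (π : FinPerm) : inverse (inverse π) = π := rfl

lemma Contained.inverse {σ π : FinPerm} (h : Contained σ π) :
    Contained (inverse σ) (inverse π) := by
  obtain ⟨n, p⟩ := π
  obtain ⟨k, s⟩ := σ
  obtain ⟨f, hf⟩ := contained_iff.1 h
  refine Occ.contained (f := fun i : Fin k => p (f (s.symm i))) (occ_of_strictMono ?_ ?_)
  · intro (i : Fin k) (j : Fin k) hij
    refine (hf.2 _ _).1 ?_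
    change s (s.symm i) < s (s.symm j)
    rwa [Equiv.apply_symm_apply, Equiv.apply_symm_apply]
  · intro (i : Fin k) (j : Fin k) hij
    change p.symm (p (f (s.symm (s i)))) < p.symm (p (f (s.symm (s j))))
    simpa using hf.1 hij

/-! ### Simple permutations -/

/-- `I` is an interval: no entry outside separates its members by position or by value. -/
def IsInterval (π : FinPerm) (I : Set (Fin π.1)) : Prop :=
  ∀ x ∉ I, ∀ a ∈ I, ∀ b ∈ I, (x < a ↔ x < b) ∧ (π.2 x < π.2 a ↔ π.2 x < π.2 b)

/-- A simple permutation has only trivial intervals. -/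
def IsSimple (π : FinPerm) : Prop :=
  ∀ I : Set (Fin π.1), IsInterval π I → I.Subsingleton ∨ I = Set.univ

lemma IsSimple.reverse {π : FinPerm} (h : IsSimple π) : IsSimple (reverse π) := by
  obtain ⟨n, p⟩ := π
  intro (I : Set (Fin n)) hI
  have h1 : IsInterval ⟨n, p⟩ {i : Fin n | i.rev ∈ I} := by
    intro (x : Fin n) hx (a : Fin n) ha (b : Fin n) hb
    have hxa : x ≠ a := by rintro rfl; exact hx ha
    have hxb : x ≠ b := by rintro rfl; exact hx hb
    obtain ⟨h1, h2⟩ := hI x.rev hx a.rev ha b.rev hb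
    change p x.rev.rev < p a.rev.rev ↔ p x.rev.rev < p b.rev.rev at h2
    rw [Fin.rev_rev, Fin.rev_rev, Fin.rev_rev] at h2
    change x.rev < a.rev ↔ x.rev < b.rev at h1
    rw [Fin.rev_lt_rev, Fin.rev_lt_rev] at h1
    exact ⟨by change x < a ↔ x < b; omega, h2⟩
  rcases h _ h1 with h2 | h2
  · left
    intro (x : Fin n) hx (y : Fin n) hy
    refine Fin.rev_injective (h2 (?_ : x.rev.rev ∈ I) (?_ : y.rev.rev ∈ I)) <;>
      rwa [Fin.rev_rev]
  · right
    refine Set.eq_univ_iff_forall.2 fun (x : Fin n) => ?_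
    have : x.rev.rev ∈ I := Set.eq_univ_iff_forall.1 h2 x.rev
    rwa [Fin.rev_rev] at this

lemma IsSimple.inverse {π : FinPerm} (h : IsSimple π) : IsSimple (inverse π) := by
  obtain ⟨n, p⟩ := π
  intro (I : Set (Fin n)) hI
  have h1 : IsInterval ⟨n, p⟩ {i : Fin n | p i ∈ I} := by
    intro (x : Fin n) hx (a : Fin n) ha (b : Fin n) hb
    obtain ⟨h1, h2⟩ := hI (p x) hx (p a) ha (p b) hb
    change p.symm (p x) < p.symm (p a) ↔ p.symm (p x) < p.symm (p b) at h2
    simp only [Equiv.symm_apply_apply] at h2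
    exact ⟨h2, h1⟩
  rcases h _ h1 with h2 | h2
  · left
    intro (x : Fin n) hx (y : Fin n) hy
    refine p.symm.injective (h2 (?_ : p (p.symm x) ∈ I) (?_ : p (p.symm y) ∈ I)) <;>
      rwa [Equiv.apply_symm_apply]
  · right
    refine Set.eq_univ_iff_forall.2 fun (x : Fin n) => ?_
    have : p (p.symm x) ∈ I := Set.eq_univ_iff_forall.1 h2 (p.symm x)
    rwa [Equiv.apply_symm_apply] at this

/-- A proper subset with at least two members is not an interval of a simple permutation. -/
lemma IsSimple.exists_not_mem {π : FinPerm} (h : IsSimple π) {I : Set (Fin π.1)} {a b c : Fin π.1}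
    (ha : a ∈ I) (hb : b ∈ I) (hab : a ≠ b) (hc : c ∉ I) : ¬ IsInterval π I := by
  intro hI
  rcases h I hI with h | h
  · exact hab (h ha hb)
  · exact hc (h ▸ Set.mem_univ c)

/-! ### Sum indecomposable sets of entries -/

/-- The entries in the positions `S` cannot be split into two parts one of which lies to the left
of and below the other. -/
def IndecOn (π : FinPerm) (S : Set (Fin π.1)) : Prop :=
  ∀ A B : Set (Fin π.1), A.Nonempty → B.Nonempty → A ∪ B = S →
    ∃ a ∈ A, ∃ b ∈ B, ¬ (a < b ∧ π.2 a < π.2 b)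

/-- `π` is not the direct sum of two nonempty permutations. -/
def Indec (π : FinPerm) : Prop := IndecOn π Set.univ

/-- If `A` lies to the left of and below `B`, then `A` consists of the positions before the first
one of `B`, and an inversion across that cut contradicts this. For explicit permutations the
criterion is decidable. -/
lemma indec_of_cuts {π : FinPerm}
    (h : ∀ k : Fin π.1, 0 < (k : ℕ) → ∃ i j, i < k ∧ k ≤ j ∧ π.2 j < π.2 i) : Indec π := by
  intro A B hA hB hAB
  by_contra! hc
  obtain ⟨k, hk, hmin⟩ := Set.exists_min_image B id (Set.toFinite B) hB
  simp only [id] at hmin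
  obtain ⟨a, ha⟩ := hA
  have hak := (hc a ha k hk).1
  obtain ⟨i, j, hik, hkj, hji⟩ := h k (by have := Fin.lt_def.1 hak; omega)
  have hmem : ∀ x, x ∈ A ∨ x ∈ B := fun x => by
    have : x ∈ A ∪ B := hAB ▸ Set.mem_univ x
    exact this
  have hi : i ∈ A := (hmem i).resolve_right fun h => absurd (hmin i h) (not_le.2 hik)
  have hj : j ∈ B := (hmem j).resolve_left fun h => absurd (hc j h k hk).1 (not_lt.2 hkj)
  exact absurd (hc i hi j hj).2 (not_lt.2 hji.le)

lemma Indec.exists_cut {π : FinPerm} (h : Indec π) {k : ℕ} (h0 : 0 < k) (hk : k < π.1) :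
    ∃ i j : Fin π.1, (i : ℕ) < k ∧ k ≤ j ∧ π.2 j < π.2 i := by
  obtain ⟨a, ha, b, hb, hab⟩ := h {i | (i : ℕ) < k} {i | k ≤ (i : ℕ)} ⟨⟨0, by omega⟩, h0⟩
    ⟨⟨k, hk⟩, le_refl k⟩ (by ext i; simp [lt_or_ge])
  have ha : (a : ℕ) < k := ha
  have hb : k ≤ (b : ℕ) := hb
  have hlt : a < b := Fin.lt_def.2 (by omega)
  refine ⟨a, b, ha, hb, lt_of_le_of_ne (not_lt.1 fun h => hab ⟨hlt, h⟩) fun he => ?_⟩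
  exact hlt.ne' (π.2.injective he)

lemma Indec.sumIndecomposable {π : FinPerm} (h : Indec π) : SumIndecomposable π := by
  rintro ⟨α, β, hpos, b, hb, hblock, hcmp⟩
  have hne : ∀ k : Fin 2, {i | b i = k}.Nonempty := by
    intro k
    obtain ⟨f, hf, -⟩ := hblock k
    rw [← hf]
    exact ⟨f ⟨0, hpos k⟩, Set.mem_range_self _⟩
  obtain ⟨x, hx, y, hy, hxy⟩ := h _ _ (hne 0) (hne 1) (by
    ext i
    simp only [Set.mem_union, Set.mem_ofPred_eq, Set.mem_univ, iff_true]
    have := (b i).isLt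
    rcases (b i).eq_zero_or_eq_succ with h | ⟨j, h⟩
    · exact Or.inl h
    · right
      rw [h]
      have : j = 0 := Subsingleton.elim _ _
      subst this
      rfl)
  have hx : b x = 0 := hx
  have hy : b y = 1 := hy
  refine hxy ⟨?_, ?_⟩
  · by_contra hc
    have := hb (not_lt.1 hc)
    rw [hx, hy] at this
    exact absurd this (by decide)
  · rw [hcmp x y (by rw [hx, hy]; decide), hx, hy]
    decide

/-- Indecomposability passes between a pattern and the positions where it occurs. -/
lemma IsPatternAt.indec_iff {σ π : FinPerm} {S : Set (Fin π.1)} (h : IsPatternAt σ π S) :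
    Indec σ ↔ IndecOn π S := by
  obtain ⟨f, rfl, hf⟩ := h
  constructor
  · intro h A B hA hB hAB
    have hA' : A ⊆ Set.range f := hAB ▸ Set.subset_union_left
    have hB' : B ⊆ Set.range f := hAB ▸ Set.subset_union_right
    obtain ⟨a, ha, b, hb, hab⟩ := h (f ⁻¹' A) (f ⁻¹' B) (hA.preimage' hA') (hB.preimage' hB')
      (by rw [← Set.preimage_union, hAB]; simp)
    exact ⟨f a, ha, f b, hb, fun hc => hab ⟨f.lt_iff_lt.1 hc.1, (hf a b).2 hc.2⟩⟩
  · intro h A B hA hB hAB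
    obtain ⟨_, ⟨a, ha, rfl⟩, _, ⟨b, hb, rfl⟩, hab⟩ := h (f '' A) (f '' B) (hA.image f)
      (hB.image f) (by rw [← Set.image_union, hAB, Set.image_univ])
    exact ⟨a, ha, b, hb, fun hc => hab ⟨f.lt_iff_lt.2 hc.1, (hf a b).1 hc.2⟩⟩

/-- An entry that cannot be added to `S` lies entirely below and to the left of `S`, or entirely
above and to the right of it. If this held for all outside entries, `π` would split after the lower
ones or, if there are none, after `S`. -/
lemma Indec.exists_insert {π : FinPerm} (h : Indec π) {S : Set (Fin π.1)} (hS : IndecOn π S)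
    (hne : S.Nonempty) (hS' : S ≠ Set.univ) : ∃ v ∉ S, IndecOn π (insert v S) := by
  by_contra! hc
  have hside : ∀ v ∉ S, (∀ s ∈ S, v < s ∧ π.2 v < π.2 s) ∨ ∀ s ∈ S, s < v ∧ π.2 s < π.2 v := by
    intro v hv
    have hv' := hc v hv
    unfold IndecOn at hv'
    push Not at hv'
    obtain ⟨A, B, hA, hB, hAB, hlt⟩ := hv'
    have hmem : ∀ x ∈ S, x ∈ A ∨ x ∈ B := fun x hx => by
      have : x ∈ A ∪ B := hAB ▸ Set.mem_insert_of_mem v hx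
      exact this
    have hvm : v ∈ A ∨ v ∈ B := by
      have : v ∈ A ∪ B := hAB ▸ Set.mem_insert v S
      exact this
    have hsub : (∀ s ∈ S, s ∉ A) ∨ ∀ s ∈ S, s ∉ B := by
      by_contra! hcon
      obtain ⟨⟨a, ha, haA⟩, b, hb, hbB⟩ := hcon
      obtain ⟨x, hx, y, hy, hxy⟩ := hS (A ∩ S) (B ∩ S) ⟨a, haA, ha⟩ ⟨b, hbB, hb⟩ (by
        rw [← Set.union_inter_distrib_right, hAB]
        exact Set.inter_eq_right.2 (Set.subset_insert v S))
      exact hxy (hlt x hx.1 y hy.1)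
    have hin : ∀ x ∈ A ∪ B, x = v ∨ x ∈ S := fun x hx => by rw [hAB] at hx; exact hx
    rcases hsub with hs | hs
    · left
      obtain ⟨a, ha⟩ := hA
      have hav : a = v := (hin a (Or.inl ha)).resolve_right fun h => hs a h ha
      subst hav
      exact fun s hsS => hlt a ha s ((hmem s hsS).resolve_left (hs s hsS))
    · right
      obtain ⟨b, hb⟩ := hB
      have hbv : b = v := (hin b (Or.inr hb)).resolve_right fun h => hs b h hb
      subst hbv
      exact fun s hsS => hlt s ((hmem s hsS).resolve_right (hs s hsS)) b hb
  obtain ⟨s₀, hs₀⟩ := hne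
  by_cases hlow : ∃ v ∉ S, ∀ s ∈ S, v < s ∧ π.2 v < π.2 s
  · obtain ⟨v, hv, hvS⟩ := hlow
    obtain ⟨a, ha, b, hb, hab⟩ := h {v | ∀ s ∈ S, v < s ∧ π.2 v < π.2 s}
      {v | ∀ s ∈ S, v < s ∧ π.2 v < π.2 s}ᶜ ⟨v, hvS⟩
      ⟨s₀, fun hcon => lt_irrefl _ (hcon s₀ hs₀).1⟩ (Set.union_compl_self _)
    by_cases hbS : b ∈ S
    · exact hab (ha b hbS)
    · have h1 := (hside b hbS).resolve_left hb s₀ hs₀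
      have h2 := ha s₀ hs₀
      exact hab ⟨h2.1.trans h1.1, h2.2.trans h1.2⟩
  · obtain ⟨a, ha, b, hb, hab⟩ := h S Sᶜ ⟨s₀, hs₀⟩ (Set.nonempty_compl.2 hS')
      (Set.union_compl_self _)
    exact hab ((hside b hb).resolve_left (fun hcon => hlow ⟨b, hb, hcon⟩) a ha)

/-- An indecomposable pattern of an indecomposable permutation extends by one entry. -/
lemma Indec.exists_extension {σ π : FinPerm} (hπ : Indec π) (hσ : Indec σ) (h : Contained σ π)
    (h0 : 0 < σ.1) (hlt : σ.1 < π.1) :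
    ∃ τ : FinPerm, τ.1 = σ.1 + 1 ∧ Indec τ ∧ Contained σ τ ∧ Contained τ π := by
  classical
  obtain ⟨S, hS⟩ := h
  have hcard : σ.1 = S.toFinset.card := by
    apply IsPatternAt.card_eq (π := π); simpa using hS
  obtain ⟨v, hv, hvS⟩ := hπ.exists_insert (hS.indec_iff.1 hσ)
    (by rw [← Set.toFinset_nonempty, ← Finset.card_pos]; omega)
    (by rintro rfl; simp at hcard; omega)
  obtain ⟨τ, hτ⟩ := exists_pattern π (insert v S)
  refine ⟨τ, ?_, hτ.indec_iff.2 hvS, hS.contained_of_subset hτ (Set.subset_insert v S), hτ.contained⟩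
  have : τ.1 = (insert v S).toFinset.card := by
    apply IsPatternAt.card_eq (π := π); simpa using hτ
  rw [this, Set.toFinset_insert, Finset.card_insert_of_notMem (by simpa using hv), hcard]

/-- Both summands of a direct sum are intervals, so in a simple permutation both are single entries.
-/
lemma IsSimple.indec {π : FinPerm} (h : IsSimple π) (h3 : 3 ≤ π.1) : Indec π := by
  intro A B hA hB hAB
  by_contra! hc
  have hmem : ∀ x, x ∈ A ∨ x ∈ B := fun x => by
    have : x ∈ A ∪ B := hAB ▸ Set.mem_univ x
    exact this
  have hAi : IsInterval π A := by
    intro x hx a ha b hb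
    have hxB := (hmem x).resolve_left hx
    exact ⟨iff_of_false (hc a ha x hxB).1.not_gt (hc b hb x hxB).1.not_gt,
      iff_of_false (hc a ha x hxB).2.not_gt (hc b hb x hxB).2.not_gt⟩
  have hBi : IsInterval π B := by
    intro x hx a ha b hb
    have hxA := (hmem x).resolve_right hx
    exact ⟨iff_of_true (hc x hxA a ha).1 (hc x hxA b hb).1,
      iff_of_true (hc x hxA a ha).2 (hc x hxA b hb).2⟩
  obtain ⟨a, ha⟩ := hA
  obtain ⟨b, hb⟩ := hB
  have hA1 : A.Subsingleton := (h A hAi).resolve_right fun hu =>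
    lt_irrefl b (hc b (hu ▸ Set.mem_univ b) b hb).1
  have hB1 : B.Subsingleton := (h B hBi).resolve_right fun hu =>
    lt_irrefl a (hc a ha a (hu ▸ Set.mem_univ a)).1
  have hcard : (Finset.univ : Finset (Fin π.1)) ⊆ {a, b} := by
    intro x _
    rcases hmem x with hx | hx
    · simp [hA1 hx ha]
    · simp [hB1 hx hb]
  have := Finset.card_le_card hcard
  have h2 : ({a, b} : Finset (Fin π.1)).card ≤ 2 := Finset.card_le_two
  simp at this
  omega

/-! ### Patterns of length three and four -/

def p21 : FinPerm := ⟨2, ⟨![1, 0], ![1, 0], by decide, by decide⟩⟩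
def p231 : FinPerm := ⟨3, ⟨![1, 2, 0], ![2, 0, 1], by decide, by decide⟩⟩
def p312 : FinPerm := ⟨3, ⟨![2, 0, 1], ![1, 2, 0], by decide, by decide⟩⟩
def p321 : FinPerm := ⟨3, ⟨![2, 1, 0], ![2, 1, 0], by decide, by decide⟩⟩
def p2413 : FinPerm := ⟨4, ⟨![1, 3, 0, 2], ![2, 0, 3, 1], by decide, by decide⟩⟩
def p3142 : FinPerm := ⟨4, ⟨![2, 0, 3, 1], ![1, 3, 0, 2], by decide, by decide⟩⟩
def p3412 : FinPerm := ⟨4, ⟨![2, 3, 0, 1], ![2, 3, 0, 1], by decide, by decide⟩⟩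
def p2341 : FinPerm := ⟨4, ⟨![1, 2, 3, 0], ![3, 0, 1, 2], by decide, by decide⟩⟩
def p4123 : FinPerm := ⟨4, ⟨![3, 0, 1, 2], ![1, 2, 3, 0], by decide, by decide⟩⟩

lemma contained_p321 {π : FinPerm} : Contained p321 π ↔
    ∃ a b c, a < b ∧ b < c ∧ π.2 c < π.2 b ∧ π.2 b < π.2 a := by
  constructor
  · intro h
    obtain ⟨f, hf⟩ := contained_iff.1 h
    exact ⟨f (0 : Fin 3), f (1 : Fin 3), f (2 : Fin 3), hf.1 (by decide), hf.1 (by decide),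
      (hf.2 _ _).1 (by decide), (hf.2 _ _).1 (by decide)⟩
  · rintro ⟨a, b, c, h1, h2, h3, h4⟩
    refine (occ_of_strictMono (f := ![a, b, c]) (Fin.strictMono_iff_lt_succ.2 ?_)
      (Fin.strictMono_iff_lt_succ.2 ?_)).contained
    · intro (i : Fin 2)
      fin_cases i
      exacts [h1, h2]
    · intro (i : Fin 2)
      fin_cases i
      exacts [h3, h4]

lemma contained_four {σ : Equiv.Perm (Fin 4)} {π : FinPerm} {f : Fin 4 → Fin π.1}
    (h1 : f 0 < f 1) (h2 : f 1 < f 2) (h3 : f 2 < f 3)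
    (h4 : π.2 (f (σ.symm 0)) < π.2 (f (σ.symm 1))) (h5 : π.2 (f (σ.symm 1)) < π.2 (f (σ.symm 2)))
    (h6 : π.2 (f (σ.symm 2)) < π.2 (f (σ.symm 3))) : Contained ⟨4, σ⟩ π := by
  refine (occ_of_strictMono (σ := ⟨4, σ⟩) (f := f) (Fin.strictMono_iff_lt_succ.2 ?_)
    (Fin.strictMono_iff_lt_succ.2 ?_)).contained
  · intro (i : Fin 3)
    fin_cases i
    exacts [h1, h2, h3]
  · intro (i : Fin 3)
    fin_cases i
    exacts [h4, h5, h6]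

lemma contained_six {σ : Equiv.Perm (Fin 6)} {π : FinPerm} {f : Fin 6 → Fin π.1}
    (h1 : f 0 < f 1) (h2 : f 1 < f 2) (h3 : f 2 < f 3) (h4 : f 3 < f 4) (h5 : f 4 < f 5)
    (h6 : π.2 (f (σ.symm 0)) < π.2 (f (σ.symm 1))) (h7 : π.2 (f (σ.symm 1)) < π.2 (f (σ.symm 2)))
    (h8 : π.2 (f (σ.symm 2)) < π.2 (f (σ.symm 3))) (h9 : π.2 (f (σ.symm 3)) < π.2 (f (σ.symm 4)))
    (h10 : π.2 (f (σ.symm 4)) < π.2 (f (σ.symm 5))) : Contained ⟨6, σ⟩ π := by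
  refine (occ_of_strictMono (σ := ⟨6, σ⟩) (f := f) (Fin.strictMono_iff_lt_succ.2 ?_)
    (Fin.strictMono_iff_lt_succ.2 ?_)).contained
  · intro (i : Fin 5)
    fin_cases i
    exacts [h1, h2, h3, h4, h5]
  · intro (i : Fin 5)
    fin_cases i
    exacts [h6, h7, h8, h9, h10]

lemma contained_p2413 {π : FinPerm} {a b c d : Fin π.1} (h1 : a < b) (h2 : b < c) (h3 : c < d)
    (h4 : π.2 c < π.2 a) (h5 : π.2 a < π.2 d) (h6 : π.2 d < π.2 b) : Contained p2413 π :=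
  contained_four (f := ![a, b, c, d]) h1 h2 h3 h4 h5 h6

lemma exists_of_contained_four {σ : Equiv.Perm (Fin 4)} {π : FinPerm} (h : Contained ⟨4, σ⟩ π) :
    ∃ f : Fin 4 → Fin π.1, StrictMono f ∧ ∀ i j, σ i < σ j → π.2 (f i) < π.2 (f j) := by
  obtain ⟨f, hf⟩ := contained_iff.1 h
  exact ⟨f, hf.1, fun i j => (hf.2 i j).1⟩

lemma contained_p4123 {π : FinPerm} : Contained p4123 π ↔ ∃ c a₁ a₂ a₃, c < a₁ ∧ a₁ < a₂ ∧
    a₂ < a₃ ∧ π.2 a₁ < π.2 a₂ ∧ π.2 a₂ < π.2 a₃ ∧ π.2 a₃ < π.2 c := by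
  constructor
  · intro h
    obtain ⟨f, hf, hv⟩ := exists_of_contained_four h
    exact ⟨f 0, f 1, f 2, f 3, hf (by decide), hf (by decide), hf (by decide),
      hv _ _ (by decide), hv _ _ (by decide), hv _ _ (by decide)⟩
  · rintro ⟨c, a₁, a₂, a₃, h1, h2, h3, h4, h5, h6⟩
    exact contained_four (f := ![c, a₁, a₂, a₃]) h1 h2 h3 h4 h5 h6

lemma contained_p2341 {π : FinPerm} {a b c d : Fin π.1} (h1 : a < b) (h2 : b < c) (h3 : c < d)
    (h4 : π.2 d < π.2 a) (h5 : π.2 a < π.2 b) (h6 : π.2 b < π.2 c) : Contained p2341 π :=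
  contained_four (f := ![a, b, c, d]) h1 h2 h3 h4 h5 h6

lemma contained_p3412 {π : FinPerm} : Contained p3412 π ↔ ∃ a b c d, a < b ∧ b < c ∧
    c < d ∧ π.2 c < π.2 d ∧ π.2 d < π.2 a ∧ π.2 a < π.2 b := by
  constructor
  · intro h
    obtain ⟨f, hf, hv⟩ := exists_of_contained_four h
    exact ⟨f 0, f 1, f 2, f 3, hf (by decide), hf (by decide), hf (by decide),
      hv _ _ (by decide), hv _ _ (by decide), hv _ _ (by decide)⟩
  · rintro ⟨c, a₁, a₂, a₃, h1, h2, h3, h4, h5, h6⟩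
    exact contained_four (f := ![c, a₁, a₂, a₃]) h1 h2 h3 h4 h5 h6

/-! ### Simple permutations contain `2413` or `3142` -/

/-- Let `j` be the last position whose value is at most that of the first entry `s`. Some inversion
`a`, `b` crosses the cut after `j`, and `s`, `a`, `j`, `b` form 2413. -/
lemma Indec.contained_p2413 {π : FinPerm} (h : Indec π) {s t : Fin π.1} (hs : ∀ i, s ≤ i)
    (ht : ∀ i, i ≤ t) (hst : π.2 s < π.2 t) : Contained p2413 π := by
  obtain ⟨j, hj, hmax⟩ := Set.exists_max_image {i | π.2 i ≤ π.2 s} id (Set.toFinite _)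
    ⟨s, le_refl (π.2 s)⟩
  simp only [id, Set.mem_ofPred_eq] at hmax
  have hj : π.2 j ≤ π.2 s := hj
  have hgt : ∀ i, j < i → π.2 s < π.2 i := fun i hi =>
    not_le.1 fun hc => absurd (hmax i hc) (not_le.2 hi)
  have hjt : j < t := lt_of_le_of_ne (ht j) (by rintro rfl; exact absurd hst (not_lt.2 hj))
  obtain ⟨a, ha, b, hb, hab⟩ := h {i | i ≤ j} {i | j < i} ⟨j, le_refl j⟩ ⟨t, hjt⟩
    (by ext i; simp [le_or_gt])
  have ha : a ≤ j := ha
  have hb : j < b := hb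
  have hlt : a < b := ha.trans_lt hb
  have hba : π.2 b < π.2 a := lt_of_le_of_ne (not_lt.1 fun hc => hab ⟨hlt, hc⟩)
    fun he => hlt.ne' (π.2.injective he)
  have hsb := hgt b hb
  have hsa : s < a := lt_of_le_of_ne (hs a) (by rintro rfl; exact absurd hsb (not_lt.2 hba.le))
  have haj : a < j := lt_of_le_of_ne ha (by
    rintro rfl; exact absurd (hsb.trans hba) (not_lt.2 hj))
  have hjs : π.2 j < π.2 s := lt_of_le_of_ne hj fun he => by
    have := π.2.injective he
    exact absurd (hsa.trans haj) (by rw [this]; exact lt_irrefl _)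
  exact PermPattern.contained_p2413 hsa haj hb hjs hsb hba

lemma reverse_p2413 : reverse p2413 = p3142 := by
  simp only [reverse, p2413, p3142, Sigma.mk.injEq, heq_eq_eq, true_and]
  decide

lemma IsSimple.contained_p2413_or_p3142 {π : FinPerm} (h : IsSimple π) (h3 : 3 ≤ π.1) :
    Contained p2413 π ∨ Contained p3142 π := by
  obtain ⟨n, p⟩ := π
  change 3 ≤ n at h3
  have hs : ∀ i : Fin n, (⟨0, by omega⟩ : Fin n) ≤ i := fun i => Fin.le_def.2 (by simp)
  have ht : ∀ i : Fin n, i ≤ (⟨n - 1, by omega⟩ : Fin n) := fun i => Fin.le_def.2 (by simp; omega)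
  rcases lt_trichotomy (p ⟨0, by omega⟩) (p ⟨n - 1, by omega⟩) with hlt | he | hlt
  · exact Or.inl ((h.indec h3).contained_p2413 hs ht hlt)
  · have := Fin.mk.inj_iff.1 (p.injective he)
    omega
  · right
    have h1 : Contained p2413 (PermPattern.reverse ⟨n, p⟩) := by
      refine (h.reverse.indec h3).contained_p2413 (s := (⟨0, by omega⟩ : Fin n))
        (t := (⟨n - 1, by omega⟩ : Fin n)) hs ht ?_
      change p (Fin.rev _) < p (Fin.rev _)
      have e1 : Fin.rev (⟨0, by omega⟩ : Fin n) = ⟨n - 1, by omega⟩ := by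
        ext; simp [Fin.rev]
      have e2 : Fin.rev (⟨n - 1, by omega⟩ : Fin n) = ⟨0, by omega⟩ := by
        ext; simp [Fin.rev]; omega
      rw [e1, e2]
      exact hlt
    have h2 := h1.reverse
    rwa [reverse_p2413, reverse_reverse] at h2

/-! ### Separators in `321`-avoiding simple permutations -/

lemma not_contained_p321 {π : FinPerm} (h : ¬ Contained p321 π) {a b c : Fin π.1} (h1 : a < b)
    (h2 : b < c) (h3 : π.2 c < π.2 b) : π.2 a < π.2 b := by
  by_contra hc
  refine h (contained_p321.2 ⟨a, b, c, h1, h2, h3, lt_of_le_of_ne (not_lt.1 hc) fun he => ?_⟩)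
  exact h1.ne' (π.2.injective he)

/-- Two increasing entries below and to the right of `c` are separated. -/
lemma IsSimple.exists_separator {π : FinPerm} (h : IsSimple π) (h321 : ¬ Contained p321 π)
    {c a b : Fin π.1} (hca : c < a) (hab : a < b) (hv : π.2 a < π.2 b) (hbc : π.2 b < π.2 c) :
    (∃ u, a < u ∧ u < b ∧ π.2 c < π.2 u) ∨ ∃ u, u < c ∧ π.2 a < π.2 u ∧ π.2 u < π.2 b := by
  by_contra! hno
  obtain ⟨hR, hL⟩ := hno
  have no : ∀ x y z : Fin π.1, x < y → y < z → π.2 z < π.2 y → π.2 y < π.2 x → False :=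
    fun x y z h1 h2 h3 h4 => h321 (contained_p321.2 ⟨x, y, z, h1, h2, h3, h4⟩)
  have inj : ∀ x y : Fin π.1, π.2 x = π.2 y → x = y := fun x y h => π.2.injective h
  have inj' : ∀ x y : Fin π.1, x = y → π.2 x = π.2 y := fun x y h => by rw [h]
  -- Without separators, and since the entries below and to the right of `c` increase, lying between
  -- `a` and `b` in position and in value amount to the same. The entries from `a` to `b` are then
  -- an interval that misses `c`.
  have key : ∀ x, (a < x ∧ x < b) ↔ (π.2 a < π.2 x ∧ π.2 x < π.2 b) := by
    intro x
    constructor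
    · rintro ⟨h1, h2⟩
      by_contra hc
      rcases lt_or_ge (π.2 x) (π.2 a) with h3 | h3
      · exact no c a x hca h1 h3 (hv.trans hbc)
      rcases lt_or_ge (π.2 b) (π.2 x) with h4 | h4
      · have h5 := hR x h1 h2
        have h6 : π.2 x ≠ π.2 c := fun h => absurd (inj _ _ h) (hca.trans h1).ne'
        exact no c x b (hca.trans h1) h2 h4 (lt_of_le_of_ne h5 h6)
      · have h5 : π.2 a ≠ π.2 x := fun h => absurd (inj _ _ h) h1.ne
        have h6 : π.2 x ≠ π.2 b := fun h => absurd (inj _ _ h) h2.ne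
        exact hc ⟨lt_of_le_of_ne h3 h5, lt_of_le_of_ne h4 h6⟩
    · rintro ⟨h1, h2⟩
      by_contra hc
      rcases lt_or_ge x a with h3 | h3
      · rcases lt_or_ge c x with h4 | h4
        · exact no c x a h4 h3 h1 (h2.trans hbc)
        · have h5 : x ≠ c := fun h => absurd (inj' _ _ h) (h2.trans hbc).ne
          exact absurd (hL x (lt_of_le_of_ne h4 h5) h1) (not_le.2 h2)
      rcases lt_or_ge b x with h4 | h4
      · exact no c b x (hca.trans hab) h4 h2 hbc
      · have h5 : a ≠ x := fun h => absurd (inj' _ _ h) h1.ne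
        have h6 : x ≠ b := fun h => absurd (inj' _ _ h) h2.ne
        exact hc ⟨lt_of_le_of_ne h3 h5, lt_of_le_of_ne h4 h6⟩
  refine h.exists_not_mem (I := {x | a ≤ x ∧ x ≤ b}) (a := a) (b := b) (c := c)
    ⟨le_rfl, hab.le⟩ ⟨hab.le, le_rfl⟩ hab.ne (fun hc => absurd hc.1 (not_le.2 hca)) ?_
  have hval : ∀ x, a ≤ x ∧ x ≤ b → π.2 a ≤ π.2 x ∧ π.2 x ≤ π.2 b := by
    rintro x ⟨h1, h2⟩
    rcases eq_or_lt_of_le h1 with rfl | h1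
    · exact ⟨le_rfl, hv.le⟩
    rcases eq_or_lt_of_le h2 with rfl | h2
    · exact ⟨hv.le, le_rfl⟩
    exact ⟨((key x).1 ⟨h1, h2⟩).1.le, ((key x).1 ⟨h1, h2⟩).2.le⟩
  intro x hx y hy z hz
  have hx' : x < a ∨ b < x := by
    by_contra! hc
    exact hx hc
  have hxv : π.2 x < π.2 a ∨ π.2 b < π.2 x := by
    by_contra! hc
    have h5 : π.2 a ≠ π.2 x := fun h => hx (by
      rw [← inj _ _ h]; exact ⟨le_rfl, hab.le⟩)
    have h6 : π.2 x ≠ π.2 b := fun h => hx (by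
      rw [inj _ _ h]; exact ⟨hab.le, le_rfl⟩)
    have := (key x).2 ⟨lt_of_le_of_ne hc.1 h5, lt_of_le_of_ne hc.2 h6⟩
    exact hx ⟨this.1.le, this.2.le⟩
  have hyv := hval y hy
  have hzv := hval z hz
  obtain ⟨hy1, hy2⟩ := hy
  obtain ⟨hz1, hz2⟩ := hz
  constructor
  · rcases hx' with h1 | h1
    · exact iff_of_true (h1.trans_le hy1) (h1.trans_le hz1)
    · exact iff_of_false (hy2.trans h1.le).not_gt (hz2.trans h1.le).not_gt
  · rcases hxv with h1 | h1
    · exact iff_of_true (h1.trans_le hyv.1) (h1.trans_le hzv.1)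
    · exact iff_of_false (hyv.2.trans h1.le).not_gt (hzv.2.trans h1.le).not_gt

/-! ### Configurations forced by 4123 and by 3412. -/

def p415263 : FinPerm := ⟨6, ⟨![3, 0, 4, 1, 5, 2], ![1, 3, 5, 0, 2, 4], by decide, by decide⟩⟩
def p246135 : FinPerm := ⟨6, ⟨![1, 3, 5, 0, 2, 4], ![3, 0, 4, 1, 5, 2], by decide, by decide⟩⟩
def p251364 : FinPerm := ⟨6, ⟨![1, 4, 0, 2, 5, 3], ![2, 0, 3, 5, 1, 4], by decide, by decide⟩⟩
def p351624 : FinPerm := ⟨6, ⟨![2, 4, 0, 5, 1, 3], ![2, 4, 0, 5, 1, 3], by decide, by decide⟩⟩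

/-- Each of the pairs 12 and 23 in the 123 of 4123 is separated either from above or from the left.
The four combinations give the four permutations. -/
lemma IsSimple.contained_of_p4123 {π : FinPerm} (h : IsSimple π) (h321 : ¬ Contained p321 π)
    (hc : Contained p4123 π) : Contained p415263 π ∨ Contained p246135 π ∨ Contained p251364 π ∨
      Contained p351624 π := by
  obtain ⟨c, a₁, a₂, a₃, h1, h2, h3, h4, h5, h6⟩ := contained_p4123.1 hc
  have lt := @not_contained_p321 π h321
  rcases h.exists_separator h321 h1 h2 h4 (h5.trans h6) with ⟨u, hu1, hu2, hu3⟩ | ⟨u, hu1, hu2, hu3⟩ <;>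
  rcases h.exists_separator h321 (h1.trans h2) h3 h5 h6 with ⟨w, hw1, hw2, hw3⟩ | ⟨w, hw1, hw2, hw3⟩
  · exact Or.inl (contained_six (f := ![c, a₁, u, a₂, w, a₃]) (h1) hu1 hu2 hw1 hw2 h4 h5 h6 hu3
      (lt (hu2.trans hw1) hw2 (h6.trans hw3)))
  · exact Or.inr (Or.inr (Or.inr (contained_six (f := ![w, c, a₁, u, a₂, a₃]) hw1 h1 hu1 hu2 h3
      h4 hw2 hw3 h6 hu3)))
  · exact Or.inr (Or.inr (Or.inl (contained_six (f := ![u, c, a₁, a₂, w, a₃]) hu1 h1 h2 hw1 hw2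
      hu2 hu3 h5 h6 hw3)))
  · have huw : u < w := by
      by_contra hcon
      have hne : w ≠ u := by rintro rfl; exact absurd hu3 (not_lt.2 hw2.le)
      have := lt (lt_of_le_of_ne (not_lt.1 hcon) hne) (hu1.trans h1) hu2
      exact absurd (hu3.trans hw2) (not_lt.2 this.le)
    exact Or.inr (Or.inl (contained_six (f := ![u, w, c, a₁, a₂, a₃]) huw hw1 h1 h2 h3
      hu2 hu3 hw2 hw3 h6))

/-- The entries 1 and 2 of 3412 must be separated. A separator from above serves as the 4 of 2341;
one from the left lies before the 3, by 321-avoidance, and serves as the 2. -/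
lemma IsSimple.contained_p2341_of_p3412 {π : FinPerm} (h : IsSimple π)
    (h321 : ¬ Contained p321 π) (hc : Contained p3412 π) : Contained p2341 π := by
  obtain ⟨a, b, c, d, h1, h2, h3, h4, h5, h6⟩ := contained_p3412.1 hc
  have lt := @not_contained_p321 π h321
  rcases h.exists_separator h321 h2 h3 h4 (h5.trans h6) with ⟨u, hu1, hu2, hu3⟩ | ⟨u, hu1, hu2, hu3⟩
  · exact contained_p2341 h1 (h2.trans hu1) hu2 h5 h6 hu3
  · have hua : u < a := by
      by_contra hcon
      have hne : a ≠ u := by rintro rfl; exact absurd h5 (not_lt.2 hu3.le)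
      have := lt (lt_of_le_of_ne (not_lt.1 hcon) hne) (hu1.trans h2) hu2
      exact absurd (hu3.trans h5) (not_lt.2 this.le)
    exact contained_p2341 hua h1 h2 hu2 (hu3.trans h5) h6

/-! ### Sum indecomposable permutations avoiding 321, 3412, 2341 and 4123. -/

/-- A sequence of values `q 0, …, q (n - 1)` that forms a sum indecomposable permutation avoiding
`321`, `3412`, `2341` and `4123`. -/
structure OscillationLike (n : ℕ) (q : ℕ → ℕ) : Prop where
  two_le : 2 ≤ n
  lt : ∀ i < n, q i < n
  inj : ∀ i < n, ∀ j < n, q i = q j → i = j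
  surj : ∀ v < n, ∃ i < n, q i = v
  cut : ∀ k, 0 < k → k < n → ∃ i < k, ∃ j < n, k ≤ j ∧ q j < q i
  no321 : ∀ a b c, a < b → b < c → c < n → q c < q b → q b < q a → False
  no3412 : ∀ a b c d, a < b → b < c → c < d → d < n → q c < q d → q d < q a → q a < q b → False
  no2341 : ∀ a b c d, a < b → b < c → c < d → d < n → q d < q a → q a < q b → q b < q c → False
  no4123 : ∀ a b c d, a < b → b < c → c < d → d < n → q b < q c → q c < q d → q d < q a → False

/-- Before position `k` all values below `k` except `a` occur, and one further value `b`. -/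
structure CutState (n : ℕ) (q : ℕ → ℕ) (k a b : ℕ) : Prop where
  a_lt : a < k
  le_b : k ≤ b
  exists_b : ∃ u < k, q u = b
  exists_a : ∃ l < n, k ≤ l ∧ q l = a
  left : ∀ i < k, q i < k ∨ q i = b
  right : ∀ j < n, k ≤ j → k ≤ q j ∨ q j = a

namespace OscillationLike

variable {n : ℕ} {q : ℕ → ℕ}

lemma cutState_one (h : OscillationLike n q) : CutState n q 1 0 (q 0) := by
  have h2 := h.two_le
  obtain ⟨i, hi, j, hj, hij, hlt⟩ := h.cut 1 one_pos (by omega)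
  obtain rfl : i = 0 := by omega
  obtain ⟨l, hl, hl0⟩ := h.surj 0 (by omega)
  refine ⟨one_pos, by omega, ⟨0, one_pos, rfl⟩, ⟨l, hl, ?_, hl0⟩, fun i hi => ?_, fun j hj h => ?_⟩
  · by_contra hc
    obtain rfl : l = 0 := by omega
    omega
  · right; congr 1; omega
  · omega

/-- If the excess value is `k` itself, then position `k` cannot receive the missing value `a`: the
first `k + 1` values would be those up to `k`, and no inversion would cross the next cut. So `a`
stays missing and `q k` is the new excess. -/
lemma step_up (h : OscillationLike n q) {k a b : ℕ} (hs : CutState n q k a b) (hk : k + 1 < n)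
    (hb : b = k) : CutState n q (k + 1) a (q k) := by
  obtain ⟨hak, hkb, ⟨u, hu, hub⟩, ⟨l, hl, hkl, hla⟩, hleft, hright⟩ := hs
  subst hb
  have hxb : q b ≠ b := fun he => by
    have := h.inj u (by omega) b (by omega) (by omega)
    omega
  have hxa : q b ≠ a := by
    intro hxa
    obtain ⟨i, hi, j, hj, hij, hlt⟩ := h.cut (b + 1) (by omega) hk
    have h1 : q i ≤ b := by
      rcases Nat.lt_succ_iff_lt_or_eq.1 hi with h1 | rfl
      · have := hleft i h1; omega
      · omega
    have h2 := hright j hj (by omega)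
    have h3 : q j ≠ a := fun he => by
      have := h.inj j hj b (by omega) (by omega)
      omega
    omega
  have hx := hright b (by omega) le_rfl
  refine ⟨by omega, by omega, ⟨b, by omega, rfl⟩, ⟨l, hl, ?_, hla⟩, fun i hi => ?_, fun j hj hbj => ?_⟩
  · rcases eq_or_lt_of_le hkl with rfl | h1
    · exact absurd hla hxa
    · omega
  · rcases Nat.lt_succ_iff_lt_or_eq.1 hi with h1 | rfl
    · have := hleft i h1; omega
    · omega
  · have h1 := hright j hj (by omega)
    have h2 : q j ≠ b := fun he => by
      have := h.inj j hj u (by omega) (by omega)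
      omega
    omega

/-- If the excess exceeds `k`, then the value `k` is still to come. Any entry other than `a` in
position `k` would create 321 or 3412 together with the excess `b`, the late `a` and possibly the
value `k`. -/
lemma step_down (h : OscillationLike n q) {k a b : ℕ} (hs : CutState n q k a b) (hk : k + 1 < n)
    (hb : k < b) : q k = a ∧ CutState n q (k + 1) k b := by
  obtain ⟨hak, hkb, ⟨u, hu, hub⟩, ⟨l, hl, hkl, hla⟩, hleft, hright⟩ := hs
  obtain ⟨m, hm, hmk⟩ := h.surj k (by omega)
  have hmk' : k ≤ m := by
    by_contra hc
    have := hleft m (by omega)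
    omega
  have hxa : q k = a := by
    by_contra hxa
    have hx := (hright k (by omega) le_rfl).resolve_right hxa
    have hlk : k < l := lt_of_le_of_ne hkl (by rintro rfl; exact hxa hla)
    have hxb : q k ≠ b := fun he => by
      have := h.inj u (by omega) k (by omega) (by omega)
      omega
    have hbx : b < q k := by
      by_contra hc
      exact h.no321 u k l hu hlk hl (by omega) (by omega)
    have hkm : k < m := lt_of_le_of_ne hmk' (by rintro rfl; omega)
    have hml : m ≠ l := by rintro rfl; omega
    rcases lt_or_gt_of_ne hml with h1 | h1
    · exact h.no321 u m l (by omega) h1 hl (by omega) (by omega)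
    · exact h.no3412 u k l m hu hlk h1 hm (by omega) (by omega) (by omega)
  refine ⟨hxa, by omega, by omega, ⟨u, by omega, hub⟩, ⟨m, hm, ?_, hmk⟩, fun i hi => ?_,
    fun j hj hbj => ?_⟩
  · rcases eq_or_lt_of_le hmk' with rfl | h1
    · omega
    · omega
  · rcases Nat.lt_succ_iff_lt_or_eq.1 hi with h1 | rfl
    · have := hleft i h1; omega
    · omega
  · have h1 := hright j hj (by omega)
    have h2 : q j ≠ a := fun he => by
      have := h.inj j hj k (by omega) (by omega)
      omega
    omega

/-- A larger excess would force two consecutive steps down, and the excess followed by `a`, `k` and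
`k + 1` would form 4123. -/
lemma eq_succ_of_lt (h : OscillationLike n q) {k a b : ℕ} (hs : CutState n q k a b) (hb : k < b) :
    b = k + 1 := by
  obtain ⟨u, hu, hub⟩ := hs.exists_b
  have hak := hs.a_lt
  obtain ⟨l₀, hl₀, hkl₀, -⟩ := hs.exists_a
  have hbn := h.lt u (by omega)
  by_contra hne
  obtain ⟨h1, hs1⟩ := h.step_down hs (by omega) hb
  obtain ⟨h2, hs2⟩ := h.step_down hs1 (by omega) (by omega)
  obtain ⟨l, hl, hkl, hla⟩ := hs2.exists_a
  exact h.no4123 u k (k + 1) l hu (by omega) (by omega) hl (by omega) (by omega) (by omega)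

/-- Two consecutive steps up would, with the old excess and the missing value, form 2341. So the
next step goes down, which fixes the new excess. -/
lemma apply_of_up (h : OscillationLike n q) {k a : ℕ} (hs : CutState n q k a k) (hk : k + 2 < n) :
    q k = k + 2 := by
  have hs1 := h.step_up hs (by omega) rfl
  have h1 := hs1.le_b
  rcases eq_or_lt_of_le h1 with h2 | h2
  · have hs2 := h.step_up hs1 (by omega) h2.symm
    have h3 := hs2.le_b
    obtain ⟨u, hu, hub⟩ := hs.exists_b
    obtain ⟨l, hl, hkl, hla⟩ := hs2.exists_a
    have := hs.a_lt
    exact (h.no2341 u k (k + 1) l hu (by omega) (by omega) hl (by omega) (by omega)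
      (by omega)).elim
  · exact h.eq_succ_of_lt hs1 h2

/-- Steps up and down alternate; the steps up are made at the positions of the parity of `e`. -/
lemma exists_cutState (h : OscillationLike n q) {e : ℕ} (he : e = if q 0 = 1 then 1 else 0)
    (k : ℕ) (h0 : 0 < k) (hk : k < n) :
    (k % 2 = e → CutState n q k (k - 1) k) ∧
    (k % 2 ≠ e → ∃ b, CutState n q k (k - 2) b ∧ (k + 1 < n → b = k + 1) ∧ q (k - 1) = b) := by
  induction k, h0 using Nat.le_induction with
  | base =>
    have hs := h.cutState_one
    constructor
    · intro h1
      have hq : q 0 = 1 := by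
        by_contra hc
        rw [if_neg hc] at he
        omega
      rwa [hq] at hs
    · intro h1
      have hq : q 0 ≠ 1 := by
        intro hc
        rw [if_pos hc] at he
        omega
      have := hs.le_b
      exact ⟨q 0, hs, fun _ => h.eq_succ_of_lt hs (by omega), rfl⟩
  | succ k hk1 ih =>
    obtain ⟨ih1, ih2⟩ := ih (by omega)
    have hee : e < 2 := by split_ifs at he <;> omega
    constructor
    · intro h1
      obtain ⟨b, hs, hb, -⟩ := ih2 (by omega)
      obtain rfl := hb hk
      exact (h.step_down hs hk (by omega)).2
    · intro h1
      have hs := ih1 (by omega)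
      exact ⟨q k, h.step_up hs hk rfl, fun h2 => h.apply_of_up hs (by omega), rfl⟩

/-- The values of an oscillation. -/
lemma apply_eq (h : OscillationLike n q) {e : ℕ} (he : e = if q 0 = 1 then 1 else 0) :
    (e = 0 → q 0 = 2) ∧ (e = 1 → q 0 = 1) ∧
    (∀ k, 0 < k → k + 1 < n → k % 2 = e → q k = min (k + 2) (n - 1)) ∧
    (∀ k, 0 < k → k + 1 < n → k % 2 ≠ e → q k = k - 2) ∧
    ((n - 1) % 2 = e → q (n - 1) = n - 2) ∧ ((n - 1) % 2 ≠ e → q (n - 1) = n - 3) := by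
  have h2 := h.two_le
  have hlast : ∀ a b, CutState n q (n - 1) a b → q (n - 1) = a := by
    intro a b hs
    obtain ⟨l, hl, hkl, hla⟩ := hs.exists_a
    obtain rfl : l = n - 1 := by omega
    exact hla
  have hq1 := h.cutState_one.le_b
  have hq2 := h.lt 0 (by omega)
  refine ⟨fun h0 => ?_, fun h1 => ?_, fun k h0 hk hke => ?_, fun k h0 hk hke => ?_, fun h1 => ?_,
    fun h1 => ?_⟩
  · have : q 0 ≠ 1 := by
      intro hc; rw [if_pos hc] at he; omega
    exact h.eq_succ_of_lt h.cutState_one (by omega)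
  · by_contra hc
    rw [if_neg hc] at he
    omega
  · have hs := (h.exists_cutState he k h0 (by omega)).1 hke
    by_cases hk2 : k + 2 < n
    · rw [h.apply_of_up hs hk2]
      omega
    · have h3 := (h.step_up hs hk rfl).le_b
      have h4 := h.lt k (by omega)
      omega
  · obtain ⟨b, hs, hb, -⟩ := (h.exists_cutState he k h0 (by omega)).2 hke
    obtain rfl := hb hk
    exact (h.step_down hs hk (by omega)).1
  · rw [hlast _ _ ((h.exists_cutState he (n - 1) (by omega) (by omega)).1 h1)]
    omega
  · obtain ⟨b, hs, -⟩ := (h.exists_cutState he (n - 1) (by omega) (by omega)).2 h1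
    rw [hlast _ _ hs]
    omega

lemma oscSeq_eq (i : ℕ) : (i % 2 = 0 → oscSeq i = i + 4) ∧ (i % 2 = 1 → oscSeq i = i) := by
  unfold oscSeq
  constructor <;> intro h
  · rw [if_pos (Nat.even_iff.2 h)]
  · rw [if_neg (by rw [Nat.even_iff]; omega)]

/-- By `apply_eq`, `q` is determined by `n` and by `q 0`, so only the two possible beginnings and
the two possible ends have to be located in the oscillating sequence. -/
theorem exists_oscSeq (h : OscillationLike n q) : ∃ f : ℕ → ℕ,
    (∀ i j, i < j → j < n → f i < f j) ∧
    ∀ i < n, ∀ j < n, q i < q j → oscSeq (f i) < oscSeq (f j) := by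
  obtain ⟨e, he⟩ : ∃ e, e = if q 0 = 1 then 1 else 0 := ⟨_, rfl⟩
  have hee : e = 0 ∨ e = 1 := by split_ifs at he <;> omega
  have h2 := h.two_le
  obtain ⟨v1, v2, v3, v4, v5, v6⟩ := h.apply_eq he
  -- A beginning with `q 0 = 1` skips the term of index 1. If the last position is one where a step
  -- up was due, there is no room for it, and one term is skipped so that a lower term takes its
  -- place.
  obtain ⟨f, hf⟩ : ∃ f : ℕ → ℕ, ∀ i, f i = i + (if e = 1 ∧ 0 < i then 1 else 0) +
    (if i = n - 1 ∧ (n - 1) % 2 = e then 1 else 0) := ⟨_, fun _ => rfl⟩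
  have hf0 : f 0 = 0 := by
    rw [hf, if_neg (by omega), if_neg (by omega)]
  have hf1 : ∀ i, 0 < i → i + 1 < n → f i = i + e := by
    intro i h0 hi
    rw [hf, if_neg (c := i = n - 1 ∧ _) (by omega)]
    split_ifs <;> omega
  have hf2 : (n - 1) % 2 = e → f (n - 1) = n + e := by
    intro h1
    rw [hf, if_pos (c := _ = _ ∧ _) ⟨rfl, h1⟩]
    split_ifs <;> omega
  have hf3 : (n - 1) % 2 ≠ e → f (n - 1) = n - 1 + e := by
    intro h1
    rw [hf, if_neg (c := _ = n - 1 ∧ _) (by omega)]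
    split_ifs <;> omega
  have hq : ∀ i < n, (i = 0 ∧ oscSeq (f i) = 4 ∧ q i + e = 2) ∨
      (0 < i ∧ i + 1 < n ∧ i % 2 = e ∧ oscSeq (f i) = i + e + 4 ∧ q i = min (i + 2) (n - 1)) ∨
      (0 < i ∧ i % 2 ≠ e ∧ oscSeq (f i) = i + e ∧ q i = i - 2) ∨
      (0 < i ∧ i + 1 = n ∧ i % 2 = e ∧ oscSeq (f i) = i + 1 + e ∧ q i = i - 1) := by
    intro i hi
    rcases Nat.eq_zero_or_pos i with rfl | h0
    · left
      rw [hf0]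
      have := (oscSeq_eq 0).1 rfl
      omega
    right
    by_cases hin : i + 1 < n
    · rw [hf1 i h0 hin]
      have h3 := oscSeq_eq (i + e)
      by_cases hie : i % 2 = e
      · exact Or.inl ⟨h0, hin, hie, h3.1 (by omega), v3 i h0 hin hie⟩
      · exact Or.inr (Or.inl ⟨h0, hie, h3.2 (by omega), v4 i h0 hin hie⟩)
    · right
      obtain rfl : i = n - 1 := by omega
      by_cases hie : (n - 1) % 2 = e
      · have h3 := oscSeq_eq (n + e)
        rw [hf2 hie, v5 hie, h3.2 (by omega)]
        omega
      · have h3 := oscSeq_eq (n - 1 + e)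
        rw [hf3 hie, v6 hie, h3.2 (by omega)]
        omega
  refine ⟨f, fun i j hij hj => ?_, fun i hi j hj hij => ?_⟩
  · rw [hf, hf]
    split_ifs <;> omega
  · have h3 := hq i hi
    have h4 := hq j hj
    clear hq v1 v2 v3 v4 v5 v6 hf hf0 hf1 hf2 hf3 he h
    rcases h3 with h3 | h3 | h3 | h3 <;> rcases h4 with h4 | h4 | h4 | h4 <;> omega

end OscillationLike

/-! ### Membership in the class of oscillations -/

lemma oscSeq_injective : Function.Injective oscSeq := by
  intro i j h
  have h1 := OscillationLike.oscSeq_eq i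
  have h2 := OscillationLike.oscSeq_eq j
  omega

/-- Every permutation order isomorphic to a subsequence of the increasing oscillating sequence is
contained in an increasing oscillation. -/
lemma mem_oscillationClass_of_oscSeq {n : ℕ} {p : Equiv.Perm (Fin n)} (f : ℕ → ℕ)
    (hf : ∀ i j, i < j → j < n → f i < f j)
    (hv : ∀ i j : Fin n, p i < p j → oscSeq (f i) < oscSeq (f j)) :
    (⟨n, p⟩ : FinPerm) ∈ oscillationClass := by
  -- The length is even so that an inversion crosses every cut: positions `k - 2`, `k + 1` for even
  -- `k` and `k - 1`, `k` for odd `k`. An initial segment of odd length would end with its maximum.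
  set N := 2 * (f (n - 1) + 1) with hN
  have hfN : ∀ i : Fin n, f i < N := by
    intro i
    rcases eq_or_lt_of_le (Nat.le_sub_one_of_lt i.isLt) with h | h
    · rw [h]; omega
    · have := hf i (n - 1) h (by omega)
      omega
  obtain ⟨σ, hσ⟩ := exists_perm_of_injective (fun i : Fin N => oscSeq i)
    (oscSeq_injective.comp Fin.val_injective)
  refine ⟨⟨N, σ⟩, Or.inl ⟨Indec.sumIndecomposable (indec_of_cuts ?_),
    Fin.valOrderEmb N, hσ⟩, ?_⟩
  · intro (k : Fin N) hk
    have hkN := k.isLt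
    have key : ∀ a b : ℕ, ∀ ha : a < N, ∀ hb : b < N, a < k → (k : ℕ) ≤ b → oscSeq b < oscSeq a →
        ∃ i j : Fin N, i < k ∧ k ≤ j ∧ σ j < σ i := fun a b ha hb h1 h2 h3 =>
      ⟨⟨a, ha⟩, ⟨b, hb⟩, Fin.lt_def.2 h1, Fin.le_def.2 h2, (hσ _ _).2 h3⟩
    rcases Nat.mod_two_eq_zero_or_one k with h | h
    · have h1 := (OscillationLike.oscSeq_eq (k - 2)).1 (by omega)
      have h2 := (OscillationLike.oscSeq_eq (k + 1)).2 (by omega)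
      exact key (k - 2) (k + 1) (by omega) (by omega) (by omega) (by omega) (by omega)
    · have h1 := (OscillationLike.oscSeq_eq (k - 1)).1 (by omega)
      have h2 := (OscillationLike.oscSeq_eq k).2 (by omega)
      exact key (k - 1) k (by omega) (by omega) (by omega) (by omega) (by omega)
  · refine Occ.contained (f := fun i : Fin n => (⟨f i, hfN i⟩ : Fin N)) ⟨?_, ?_⟩
    · intro (i : Fin n) (j : Fin n) hij
      exact Fin.lt_def.2 (hf i j hij j.isLt)
    · have h1 : ∀ i j : Fin n, p i < p j →
          σ ⟨f i, hfN i⟩ < σ ⟨f j, hfN j⟩ := fun i j h => (hσ _ _).2 (hv i j h)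
      intro (i : Fin n) (j : Fin n)
      refine ⟨h1 i j, fun h => ?_⟩
      by_contra hc
      rcases eq_or_lt_of_le (not_lt.1 hc) with he | hlt
      · rw [p.injective he] at h
        exact lt_irrefl _ h
      · exact absurd (h1 j i hlt) (not_lt.2 (le_of_lt h))

/-- Simplicity gives avoidance of 3412 and, from length three on, sum indecomposability, so the cut
analysis applies. Shorter permutations are treated by hand. -/
lemma IsSimple.mem_oscillationClass {π : FinPerm} (h : IsSimple π) (h321 : ¬ Contained p321 π)
    (h4123 : ¬ Contained p4123 π) (h2341 : ¬ Contained p2341 π) : π ∈ oscillationClass := by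
  have h3412 : ¬ Contained p3412 π := fun hc => h2341 (h.contained_p2341_of_p3412 h321 hc)
  obtain ⟨n, p⟩ := π
  by_cases hn : 3 ≤ n
  · set q : ℕ → ℕ := fun i => if h : i < n then p ⟨i, h⟩ else 0 with hq
    have hqv : ∀ i (hi : i < n), q i = p ⟨i, hi⟩ := fun i hi => dif_pos hi
    have hO : OscillationLike n q := by
      refine ⟨by omega, fun i hi => ?_, fun i hi j hj hij => ?_, fun v hv => ?_, fun k h0 hk => ?_,
        fun a b c h1 h2 h3 h4 h5 => ?_, fun a b c d h1 h2 h3 h4 h5 h6 h7 => ?_,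
        fun a b c d h1 h2 h3 h4 h5 h6 h7 => ?_, fun a b c d h1 h2 h3 h4 h5 h6 h7 => ?_⟩
      · rw [hqv i hi]; exact (p _).isLt
      · rw [hqv i hi, hqv j hj] at hij
        exact Fin.mk.inj_iff.1 (p.injective (Fin.val_injective hij))
      · refine ⟨p.symm ⟨v, hv⟩, (p.symm ⟨v, hv⟩).isLt, ?_⟩
        rw [hqv _ (p.symm ⟨v, hv⟩).isLt]
        simp
      · obtain ⟨i, j, hi, hj, hji⟩ := (h.indec hn).exists_cut h0 hk
        refine ⟨i, hi, j, j.isLt, hj, ?_⟩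
        rw [hqv i i.isLt, hqv j j.isLt]
        exact hji
      · rw [hqv c h3, hqv b (by omega)] at h4
        rw [hqv a (by omega), hqv b (by omega)] at h5
        exact h321 (contained_p321.2 ⟨_, _, _, Fin.mk_lt_mk.2 h1, Fin.mk_lt_mk.2 h2, h4, h5⟩)
      all_goals
        simp only [hqv a (by omega), hqv b (by omega), hqv c (by omega), hqv d (by omega)]
          at h5 h6 h7
      · exact h3412 (contained_p3412.2 ⟨_, _, _, _, Fin.mk_lt_mk.2 h1, Fin.mk_lt_mk.2 h2,
          Fin.mk_lt_mk.2 h3, h5, h6, h7⟩)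
      · exact h2341 (contained_p2341 (Fin.mk_lt_mk.2 h1) (Fin.mk_lt_mk.2 h2)
          (Fin.mk_lt_mk.2 h3) h5 h6 h7)
      · exact h4123 (contained_p4123.2 ⟨_, _, _, _, Fin.mk_lt_mk.2 h1, Fin.mk_lt_mk.2 h2,
          Fin.mk_lt_mk.2 h3, h5, h6, h7⟩)
    obtain ⟨f, hf, hv⟩ := hO.exists_oscSeq
    refine mem_oscillationClass_of_oscSeq f hf fun i j hij => hv i i.isLt j j.isLt ?_
    rw [hqv i i.isLt, hqv j j.isLt]
    exact hij
  · by_cases hinc : ∃ i j : Fin n, i < j ∧ p j < p i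
    · obtain ⟨a, b, hab, hba⟩ := hinc
      refine mem_oscillationClass_of_oscSeq id (fun i j h _ => h) fun i j hij => ?_
      have hne : i ≠ j := by rintro rfl; exact lt_irrefl _ hij
      have hij' : j < i := by
        by_contra hc
        have h1 : i = a := by omega
        have h2 : j = b := by omega
        subst h1 h2
        exact absurd hij (not_lt.2 hba.le)
      have h1 : (i : ℕ) = 1 := by omega
      have h2 : (j : ℕ) = 0 := by omega
      rw [h1, h2]
      decide
    -- The terms of even index increase.
    · refine mem_oscillationClass_of_oscSeq (fun i => 2 * i) (fun i j h _ => by omega)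
        fun i j hij => ?_
      have hij' : i < j := by
        by_contra hc
        have hne : i ≠ j := by rintro rfl; exact lt_irrefl _ hij
        exact hinc ⟨j, i, by omega, hij⟩
      have h1 := (OscillationLike.oscSeq_eq (2 * i)).1 (by omega)
      have h2 := (OscillationLike.oscSeq_eq (2 * j)).1 (by omega)
      omega

lemma reverse_mem_oscillationClass {π : FinPerm} (h : π ∈ oscillationClass) :
    reverse π ∈ oscillationClass := by
  obtain ⟨σ, hσ, hπ⟩ := h
  refine ⟨reverse σ, ?_, hπ.reverse⟩
  rcases hσ with hσ | ⟨τ, hτ, rfl⟩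
  · exact Or.inr ⟨σ, hσ, rfl⟩
  · rw [reverse_reverse]
    exact Or.inl hτ

/-! ### Permutations with many sum indecomposable patterns -/

def p1 : FinPerm := ⟨1, ⟨![0], ![0], by decide, by decide⟩⟩

lemma inverse_p1 : inverse p1 = p1 := by
  simp only [inverse, p1, Sigma.mk.injEq, heq_eq_eq, true_and]
  decide

/-- `π` contains sum indecomposable permutations, of lengths between one and six, such that the
sum of `t ^ length` over them is at least one. -/
def Rich (t : ℝ) (π : FinPerm) : Prop :=
  ∃ l : List FinPerm, p1 ∈ l ∧ l.Nodup ∧ (∀ τ ∈ l, 0 < τ.1 ∧ τ.1 ≤ 6 ∧ Indec τ ∧ Contained τ π) ∧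
    1 ≤ (l.map fun τ => t ^ τ.1).sum

lemma Rich.mono {t : ℝ} {σ π : FinPerm} (h : Rich t σ) (hσ : Contained σ π) : Rich t π := by
  obtain ⟨l, h0, h1, h2, h3⟩ := h
  exact ⟨l, h0, h1, fun τ hτ => ⟨(h2 τ hτ).1, (h2 τ hτ).2.1, (h2 τ hτ).2.2.1,
    (h2 τ hτ).2.2.2.trans hσ⟩, h3⟩

lemma Indec.inverse {π : FinPerm} (h : Indec π) : Indec (inverse π) := by
  obtain ⟨n, p⟩ := π
  intro (A : Set (Fin n)) (B : Set (Fin n)) hA hB hAB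
  obtain ⟨a, ha, b, hb, hab⟩ := h (p ⁻¹' A) (p ⁻¹' B) (hA.preimage p.surjective)
    (hB.preimage p.surjective) (by
      rw [← Set.preimage_union]
      exact (congrArg (p ⁻¹' ·) hAB).trans Set.preimage_univ)
  refine ⟨p a, ha, p b, hb, fun hc => hab ⟨?_, hc.1⟩⟩
  have := hc.2
  change p.symm (p a) < p.symm (p b) at this
  simpa using this

lemma Rich.inverse {t : ℝ} {π : FinPerm} (h : Rich t π) : Rich t (inverse π) := by
  obtain ⟨l, h0, h1, h2, h3⟩ := h
  refine ⟨l.map PermPattern.inverse, List.mem_map.2 ⟨p1, h0, inverse_p1⟩, h1.map (Function.LeftInverse.injective inverse_inverse), ?_, ?_⟩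
  · intro τ hτ
    obtain ⟨σ, hσ, rfl⟩ := List.mem_map.1 hτ
    obtain ⟨h4, h5, h6, h7⟩ := h2 σ hσ
    exact ⟨h4, h5, h6.inverse, h7.inverse⟩
  · rw [List.map_map]
    exact h3

/-! ### Richness of simple permutations outside 𝓞. -/

def p24153 : FinPerm := ⟨5, ⟨![1, 3, 0, 4, 2], ![2, 0, 4, 1, 3], by decide, by decide⟩⟩
def p25134 : FinPerm := ⟨5, ⟨![1, 4, 0, 2, 3], ![2, 0, 3, 4, 1], by decide, by decide⟩⟩
def p34152 : FinPerm := ⟨5, ⟨![2, 3, 0, 4, 1], ![2, 4, 0, 1, 3], by decide, by decide⟩⟩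
def p41253 : FinPerm := ⟨5, ⟨![3, 0, 1, 4, 2], ![1, 2, 4, 0, 3], by decide, by decide⟩⟩
def p41523 : FinPerm := ⟨5, ⟨![3, 0, 4, 1, 2], ![1, 3, 4, 0, 2], by decide, by decide⟩⟩

lemma indec_p1 : Indec p1 := indec_of_cuts (by decide)
lemma indec_p21 : Indec p21 := indec_of_cuts (by decide)
lemma indec_p231 : Indec p231 := indec_of_cuts (by decide)
lemma indec_p312 : Indec p312 := indec_of_cuts (by decide)
lemma indec_p321 : Indec p321 := indec_of_cuts (by decide)
lemma indec_p2341 : Indec p2341 := indec_of_cuts (by decide)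
lemma indec_p2413 : Indec p2413 := indec_of_cuts (by decide)
lemma indec_p3142 : Indec p3142 := indec_of_cuts (by decide)
lemma indec_p3412 : Indec p3412 := indec_of_cuts (by decide)
lemma indec_p4123 : Indec p4123 := indec_of_cuts (by decide)
lemma indec_p24153 : Indec p24153 := indec_of_cuts (by decide)
lemma indec_p25134 : Indec p25134 := indec_of_cuts (by decide)
lemma indec_p34152 : Indec p34152 := indec_of_cuts (by decide)
lemma indec_p41253 : Indec p41253 := indec_of_cuts (by decide)
lemma indec_p41523 : Indec p41523 := indec_of_cuts (by decide)
lemma indec_p251364 : Indec p251364 := indec_of_cuts (by decide)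

lemma contained_of_decide {k n : ℕ} {σ : Equiv.Perm (Fin k)} {p : Equiv.Perm (Fin n)}
    (f : Fin k → Fin n) (h : ∀ i j, (i < j → f i < f j) ∧ (σ i < σ j ↔ p (f i) < p (f j))) :
    Contained ⟨k, σ⟩ ⟨n, p⟩ :=
  Occ.contained (σ := ⟨k, σ⟩) (π := ⟨n, p⟩) (f := f) ⟨fun i j => (h i j).1, fun i j => (h i j).2⟩

/-- The number 0.4456 is slightly less than 1/γ ≈ 0.44561. These bounds suffice wherever the sum
strictly exceeds 1. -/
lemma pow_bounds {t : ℝ} (ht : 0.4456 ≤ t) :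
    0.1985 ≤ t ^ 2 ∧ 0.0884 ≤ t ^ 3 ∧ 0.0394 ≤ t ^ 4 ∧ 0.0175 ≤ t ^ 5 := by
  have h : ∀ k : ℕ, (0.4456 : ℝ) ^ k ≤ t ^ k := fun k => by gcongr
  have h2 := h 2
  have h3 := h 3
  have h4 := h 4
  have h5 := h 5
  norm_num at h2 h3 h4 h5 ⊢
  refine ⟨?_, ?_, ?_, ?_⟩ <;> linarith

lemma rich_p415263 {t : ℝ} (ht : 0.4456 ≤ t) :
    Rich t p415263 := by
  refine ⟨[p1, p21, p312, p231, p3142, p4123, p3412, p2341, p41523, p34152], by decide, by decide, ?_, ?_⟩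
  · simp only [List.mem_cons, List.not_mem_nil, or_false]
    rintro _ (rfl | rfl | rfl | rfl | rfl | rfl | rfl | rfl | rfl | rfl)
    · exact ⟨by decide, by decide, indec_p1, contained_of_decide ![0] (by decide)⟩
    · exact ⟨by decide, by decide, indec_p21, contained_of_decide ![0, 1] (by decide)⟩
    · exact ⟨by decide, by decide, indec_p312, contained_of_decide ![0, 1, 3] (by decide)⟩
    · exact ⟨by decide, by decide, indec_p231, contained_of_decide ![0, 2, 3] (by decide)⟩
    · exact ⟨by decide, by decide, indec_p3142, contained_of_decide ![0, 1, 2, 3] (by decide)⟩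
    · exact ⟨by decide, by decide, indec_p4123, contained_of_decide ![0, 1, 3, 5] (by decide)⟩
    · exact ⟨by decide, by decide, indec_p3412, contained_of_decide ![0, 2, 3, 5] (by decide)⟩
    · exact ⟨by decide, by decide, indec_p2341, contained_of_decide ![0, 2, 4, 5] (by decide)⟩
    · exact ⟨by decide, by decide, indec_p41523, contained_of_decide ![0, 1, 2, 3, 5] (by decide)⟩
    · exact ⟨by decide, by decide, indec_p34152, contained_of_decide ![0, 2, 3, 4, 5] (by decide)⟩
  · obtain ⟨h2, h3, h4, h5⟩ := pow_bounds ht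
    change 1 ≤ t ^ 1 + (t ^ 2 + (t ^ 3 + (t ^ 3 +
      (t ^ 4 + (t ^ 4 + (t ^ 4 + (t ^ 4 + (t ^ 5 + (t ^ 5 + 0)))))))))
    linarith

/-- This is the extremal case: the list has 1, 1, 2, 3, 3, 1 members of lengths one to six, which
are the coefficients of the equation for 1/γ. No numerical slack is left here. -/
lemma rich_p251364 {t : ℝ} (h : t + t ^ 2 + 2 * t ^ 3 + 3 * t ^ 4 + 3 * t ^ 5 + t ^ 6 = 1) :
    Rich t p251364 := by
  refine ⟨[p1, p21, p231, p312, p2413, p4123, p3142, p25134, p24153, p41253, p251364], by decide, by decide, ?_, ?_⟩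
  · simp only [List.mem_cons, List.not_mem_nil, or_false]
    rintro _ (rfl | rfl | rfl | rfl | rfl | rfl | rfl | rfl | rfl | rfl | rfl)
    · exact ⟨by decide, by decide, indec_p1, contained_of_decide ![0] (by decide)⟩
    · exact ⟨by decide, by decide, indec_p21, contained_of_decide ![0, 2] (by decide)⟩
    · exact ⟨by decide, by decide, indec_p231, contained_of_decide ![0, 1, 2] (by decide)⟩
    · exact ⟨by decide, by decide, indec_p312, contained_of_decide ![1, 2, 3] (by decide)⟩
    · exact ⟨by decide, by decide, indec_p2413, contained_of_decide ![0, 1, 2, 3] (by decide)⟩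
    · exact ⟨by decide, by decide, indec_p4123, contained_of_decide ![1, 2, 3, 5] (by decide)⟩
    · exact ⟨by decide, by decide, indec_p3142, contained_of_decide ![1, 2, 4, 5] (by decide)⟩
    · exact ⟨by decide, by decide, indec_p25134, contained_of_decide ![0, 1, 2, 3, 5] (by decide)⟩
    · exact ⟨by decide, by decide, indec_p24153, contained_of_decide ![0, 1, 2, 4, 5] (by decide)⟩
    · exact ⟨by decide, by decide, indec_p41253, contained_of_decide ![1, 2, 3, 4, 5] (by decide)⟩
    · exact ⟨by decide, by decide, indec_p251364, contained_of_decide ![0, 1, 2, 3, 4, 5] (by decide)⟩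
  · change 1 ≤ t ^ 1 + (t ^ 2 + (t ^ 3 + (t ^ 3 +
      (t ^ 4 + (t ^ 4 + (t ^ 4 + (t ^ 5 + (t ^ 5 + (t ^ 5 + (t ^ 6 + 0))))))))))
    linarith

lemma rich_p351624 {t : ℝ} (ht : 0.4456 ≤ t) :
    Rich t p351624 := by
  refine ⟨[p1, p21, p231, p312, p3412, p2413, p2341, p3142, p4123], by decide, by decide, ?_, ?_⟩
  · simp only [List.mem_cons, List.not_mem_nil, or_false]
    rintro _ (rfl | rfl | rfl | rfl | rfl | rfl | rfl | rfl | rfl)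
    · exact ⟨by decide, by decide, indec_p1, contained_of_decide ![0] (by decide)⟩
    · exact ⟨by decide, by decide, indec_p21, contained_of_decide ![0, 2] (by decide)⟩
    · exact ⟨by decide, by decide, indec_p231, contained_of_decide ![0, 1, 2] (by decide)⟩
    · exact ⟨by decide, by decide, indec_p312, contained_of_decide ![0, 2, 4] (by decide)⟩
    · exact ⟨by decide, by decide, indec_p3412, contained_of_decide ![0, 1, 2, 4] (by decide)⟩
    · exact ⟨by decide, by decide, indec_p2413, contained_of_decide ![0, 1, 2, 5] (by decide)⟩
    · exact ⟨by decide, by decide, indec_p2341, contained_of_decide ![0, 1, 3, 4] (by decide)⟩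
    · exact ⟨by decide, by decide, indec_p3142, contained_of_decide ![0, 2, 3, 4] (by decide)⟩
    · exact ⟨by decide, by decide, indec_p4123, contained_of_decide ![1, 2, 4, 5] (by decide)⟩
  · obtain ⟨h2, h3, h4, h5⟩ := pow_bounds ht
    change 1 ≤ t ^ 1 + (t ^ 2 + (t ^ 3 + (t ^ 3 +
      (t ^ 4 + (t ^ 4 + (t ^ 4 + (t ^ 4 + (t ^ 4 + 0))))))))
    linarith

/-- Supplies short indecomposable patterns common to all simple permutations of length at least
three. That `ρ` avoids 321 distinguishes it later from a pattern of length four grown out of 321. -/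
lemma small_patterns {π : FinPerm} (h : Contained p2413 π ∨ Contained p3142 π) :
    ∃ ρ : FinPerm, ρ.1 = 4 ∧ Indec ρ ∧ ¬ Contained p321 ρ ∧ Contained ρ π ∧
      Contained p1 π ∧ Contained p21 π ∧ Contained p231 π ∧ Contained p312 π := by
  have no321 : ∀ p : Equiv.Perm (Fin 4), (∀ a b c, ¬ (a < b ∧ b < c ∧ p c < p b ∧ p b < p a)) →
      ¬ Contained p321 ⟨4, p⟩ := fun p hp hc => by
    obtain ⟨a, b, c, h1, h2, h3, h4⟩ := contained_p321.1 hc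
    exact hp a b c ⟨h1, h2, h3, h4⟩
  rcases h with h | h
  · refine ⟨p2413, rfl, indec_p2413, no321 _ (by decide), h, ?_, ?_, ?_, ?_⟩ <;>
      refine Contained.trans ?_ h
    · exact contained_of_decide ![0] (by decide)
    · exact contained_of_decide ![0, 2] (by decide)
    · exact contained_of_decide ![0, 1, 2] (by decide)
    · exact contained_of_decide ![1, 2, 3] (by decide)
  · refine ⟨p3142, rfl, indec_p3142, no321 _ (by decide), h, ?_, ?_, ?_, ?_⟩ <;>
      refine Contained.trans ?_ h
    · exact contained_of_decide ![0] (by decide)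
    · exact contained_of_decide ![0, 1] (by decide)
    · exact contained_of_decide ![0, 2, 3] (by decide)
    · exact contained_of_decide ![0, 1, 3] (by decide)

/-- Besides the patterns from `small_patterns`, the pattern 321 extends one entry at a time to
indecomposable patterns of lengths four and five. The sum is then at least t + t² + 3t³ + 2t⁴ + t⁵ >
1. -/
lemma IsSimple.rich_of_p321 {t : ℝ} (ht : 0.4456 ≤ t) {π : FinPerm} (h : IsSimple π)
    (h321 : Contained p321 π) : Rich t π := by
  have h3 : 3 ≤ π.1 := h321.length_le
  obtain ⟨ρ, hρ4, hρ, hρ321, hρπ, c1, c21, c231, c312⟩ :=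
    small_patterns (h.contained_p2413_or_p3142 h3)
  have h4 : 4 ≤ π.1 := hρ4 ▸ hρπ.length_le
  obtain ⟨τ, hτ4, hτ, h321τ, hτπ⟩ := (h.indec h3).exists_extension indec_p321 h321
    (by decide) (show 3 < π.1 by omega)
  have hτ4 : τ.1 = 4 := hτ4
  have h5 : 4 < π.1 := by
    -- In length four `ρ` would be all of `π`, hence would contain 321.
    refine lt_of_le_of_ne h4 fun h4 => hρ321 ?_
    obtain ⟨S, hS⟩ := hρπ
    obtain ⟨T, hT⟩ := hτπ
    have hall : ∀ {σ : FinPerm} {f : Fin σ.1 → Fin π.1}, σ.1 = 4 → StrictMono f →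
        Function.Surjective f := fun {σ f} h hf =>
      ((Fintype.bijective_iff_injective_and_card f).2 ⟨hf.injective, by simp [h, h4]⟩).2
    have hS1 : S = Set.univ := by
      obtain ⟨f, hf, -⟩ := hS
      rw [← hf]
      exact (hall hρ4 f.strictMono).range_eq
    have hT1 : T ⊆ S := by rw [hS1]; exact Set.subset_univ T
    exact h321τ.trans (hT.contained_of_subset hS hT1)
  obtain ⟨ω, hω5, hω, -, hωπ⟩ := (h.indec h3).exists_extension hτ hτπ (by omega) (by omega)
  replace hω5 : ω.1 = 5 := by rw [hω5, hτ4]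
  have hne : ρ ≠ τ := by rintro rfl; exact hρ321 h321τ
  refine ⟨[p1, p21, p231, p312, p321, ρ, τ, ω], by simp, ?_, ?_, ?_⟩
  · have len : ∀ {α β : FinPerm}, α.1 ≠ β.1 → α ≠ β := fun h he => h (congrArg _ he)
    have hfst : p1.1 = 1 ∧ p21.1 = 2 ∧ p231.1 = 3 ∧ p312.1 = 3 ∧ p321.1 = 3 :=
      ⟨rfl, rfl, rfl, rfl, rfl⟩
    obtain ⟨e1, e2, e3, e4, e5⟩ := hfst
    have d : p231 ≠ p312 ∧ p231 ≠ p321 ∧ p312 ≠ p321 := by decide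
    have hx : ∀ α ∈ [p1, p21, p231, p312, p321], α ≠ ρ ∧ α ≠ τ ∧ α ≠ ω := by
      intro α hα
      have : α.1 ≤ 3 := by
        simp only [List.mem_cons, List.not_mem_nil, or_false] at hα
        rcases hα with rfl | rfl | rfl | rfl | rfl <;> decide
      exact ⟨len (by omega), len (by omega), len (by omega)⟩
    have h2 : [ρ, τ, ω].Nodup := by
      simp only [List.nodup_cons, List.mem_cons, List.not_mem_nil, or_false, not_or]
      exact ⟨⟨hne, len (by omega)⟩, len (by omega), by simp⟩
    refine List.Nodup.append (l₁ := [p1, p21, p231, p312, p321]) (by decide) h2 ?_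
    intro α h1 h3
    obtain ⟨n1, n2, n3⟩ := hx α h1
    simp only [List.mem_cons, List.not_mem_nil, or_false] at h3
    rcases h3 with h3 | h3 | h3
    exacts [n1 h3, n2 h3, n3 h3]
  · simp only [List.mem_cons, List.not_mem_nil, or_false]
    rintro _ (rfl | rfl | rfl | rfl | rfl | rfl | rfl | rfl)
    · exact ⟨by decide, by decide, indec_p1, c1⟩
    · exact ⟨by decide, by decide, indec_p21, c21⟩
    · exact ⟨by decide, by decide, indec_p231, c231⟩
    · exact ⟨by decide, by decide, indec_p312, c312⟩
    · exact ⟨by decide, by decide, indec_p321, h321⟩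
    · exact ⟨by omega, by omega, hρ, hρπ⟩
    · exact ⟨by omega, by omega, hτ, hτπ⟩
    · exact ⟨by omega, by omega, hω, hωπ⟩
  · obtain ⟨h2, h3, h4, h5⟩ := pow_bounds ht
    change 1 ≤ t ^ 1 + (t ^ 2 + (t ^ 3 + (t ^ 3 + (t ^ 3 +
      (t ^ ρ.1 + (t ^ τ.1 + (t ^ ω.1 + 0)))))))
    rw [hρ4, hτ4, hω5]
    linarith

lemma inverse_p415263 : inverse p415263 = p246135 := by
  simp only [inverse, p415263, p246135, Sigma.mk.injEq, heq_eq_eq, true_and]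
  decide

lemma inverse_p2341 : inverse p2341 = p4123 := by
  simp only [inverse, p2341, p4123, Sigma.mk.injEq, heq_eq_eq, true_and]
  decide

lemma inverse_p321 : inverse p321 = p321 := by
  simp only [inverse, p321, Sigma.mk.injEq, heq_eq_eq, true_and]
  decide

lemma IsSimple.rich_of_p4123 {t : ℝ} (ht : 0.4456 ≤ t)
    (he : t + t ^ 2 + 2 * t ^ 3 + 3 * t ^ 4 + 3 * t ^ 5 + t ^ 6 = 1) {π : FinPerm}
    (h : IsSimple π) (h321 : ¬ Contained p321 π) (hc : Contained p4123 π) : Rich t π := by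
  rcases h.contained_of_p4123 h321 hc with hc | hc | hc | hc
  · exact (rich_p415263 ht).mono hc
  · exact (inverse_p415263 ▸ (rich_p415263 ht).inverse).mono hc
  · exact (rich_p251364 he).mono hc
  · exact (rich_p351624 ht).mono hc

/-- Simple permutations that are not contained in an oscillation are rich. -/
theorem IsSimple.rich {t : ℝ} (ht : 0.4456 ≤ t)
    (he : t + t ^ 2 + 2 * t ^ 3 + 3 * t ^ 4 + 3 * t ^ 5 + t ^ 6 = 1) {π : FinPerm}
    (h : IsSimple π) (hO : π ∉ oscillationClass) : Rich t π := by
  by_cases h321 : Contained p321 π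
  · exact h.rich_of_p321 ht h321
  by_cases h4123 : Contained p4123 π
  · exact h.rich_of_p4123 ht he h321 h4123
  by_cases h2341 : Contained p2341 π
  -- Inversion fixes 321, exchanges 2341 and 4123, and preserves simplicity and richness.
  · have h1 : ¬ Contained p321 (PermPattern.inverse π) := fun hc => h321 (inverse_p321 ▸ hc.inverse)
    have h2 : Contained p4123 (PermPattern.inverse π) := inverse_p2341 ▸ h2341.inverse
    exact (h.inverse.rich_of_p4123 ht he h1 h2).inverse
  · exact absurd (h.mem_oscillationClass h321 h4123 h2341) hO

/-! ### Hitting families of rectangles with few lines. -/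

/-- An axis-parallel integer rectangle `[x₁, x₂) × [y₁, y₂)`. -/
@[ext] structure Rect where
  x₁ : ℕ
  x₂ : ℕ
  y₁ : ℕ
  y₂ : ℕ

namespace Rect

/-- Both projections of the two rectangles are disjoint. -/
def Indep (R S : Rect) : Prop :=
  (R.x₂ ≤ S.x₁ ∨ S.x₂ ≤ R.x₁) ∧ (R.y₂ ≤ S.y₁ ∨ S.y₂ ≤ R.y₁)

/-- Width and height are at least two. -/
def Thick (R : Rect) : Prop := R.x₁ + 2 ≤ R.x₂ ∧ R.y₁ + 2 ≤ R.y₂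

lemma Indep.symm {R S : Rect} (h : Indep R S) : Indep S R := ⟨h.1.symm, h.2.symm⟩

/-- Some vertical line of `V` or horizontal line of `H` crosses the interior of `R`. -/
def Hit (V H : List ℕ) (R : Rect) : Prop :=
  (∃ v ∈ V, R.x₁ < v ∧ v < R.x₂) ∨ ∃ h ∈ H, R.y₁ < h ∧ h < R.y₂

lemma Hit.mono {V H V' H' : List ℕ} {R : Rect} (h : Hit V H R) (hV : V ⊆ V') (hH : H ⊆ H') :
    Hit V' H' R := by
  rcases h with ⟨v, hv, h⟩ | ⟨v, hv, h⟩
  · exact Or.inl ⟨v, hV hv, h⟩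
  · exact Or.inr ⟨v, hH hv, h⟩

/-- `F` contains `k` pairwise independent rectangles. -/
def HasIndep (F : Set Rect) (k : ℕ) : Prop :=
  ∃ s : Finset Rect, s.card = k ∧ (∀ R ∈ s, R ∈ F) ∧ (s : Set Rect).Pairwise Indep

/-- Two neighbouring horizontal lines hit all members of the family. -/
def Pierced (A : Set Rect) : Prop := ∃ h, ∀ R ∈ A, Hit [] [h, h + 1] R

/-- If all vertical projections of two families meet across, one family is pierced. -/
lemma pierced_or_pierced {A B : Set Rect} (hA : ∀ R ∈ A, R.Thick) (hB : ∀ R ∈ B, R.Thick)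
    (hAB : ∀ R ∈ A, ∀ S ∈ B, R.y₁ < S.y₂ ∧ S.y₁ < R.y₂) : Pierced A ∨ Pierced B := by
  -- Lines are integral and must meet the open interior, so one line at the common height may run
  -- along an edge. For a thick rectangle one of two neighbouring lines is always interior.
  have key : ∀ r : ℕ, ∀ R : Rect, R.Thick → R.y₁ < r → r ≤ R.y₂ →
      Hit [] [r - 1, r - 1 + 1] R := by
    intro r R hR h1 h2
    have := hR.2
    right
    by_cases h : R.y₁ = r - 1
    · exact ⟨r - 1 + 1, by simp, by omega, by omega⟩
    · exact ⟨r - 1, by simp, by omega, by omega⟩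
  by_cases hne : ∃ r, ∃ R ∈ A ∪ B, R.y₂ = r
  · classical
    -- Take the lowest top edge in both families: all rectangles of the other family start below it
    -- and end no lower.
    obtain ⟨R, hR, hr⟩ := Nat.find_spec hne
    have hmin : ∀ S ∈ A ∪ B, R.y₂ ≤ S.y₂ := fun S hS => by
      rw [hr]; exact Nat.find_min' hne ⟨S, hS, rfl⟩
    rcases hR with hR | hR
    · exact Or.inr ⟨R.y₂ - 1, fun S hS => key _ S (hB S hS) (hAB R hR S hS).2
        (hmin S (Or.inr hS))⟩
    · exact Or.inl ⟨R.y₂ - 1, fun S hS => key _ S (hA S hS) (hAB S hS R hR).1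
        (hmin S (Or.inl hS))⟩
  · left
    exact ⟨0, fun R hR => absurd ⟨_, R, Or.inl hR, rfl⟩ hne⟩

/-- Sweep a vertical line to the first `b` for which the rectangles ending by `b` are not pierced.
Those ending by `b - 1` are pierced. Those starting from `b` on must meet every rectangle ending by
`b` in vertical projection, so they are pierced too. The rest contain `b - 1` or `b` in the interior
of their horizontal projection. -/
lemma exists_lines_of_not_hasIndep_two {F : Set Rect} {n : ℕ} (hF : ∀ R ∈ F, R.Thick)
    (hn : ∀ R ∈ F, R.x₂ ≤ n) (h2 : ¬ HasIndep F 2) :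
    ∃ V H : List ℕ, V.length ≤ 4 ∧ H.length ≤ 4 ∧ ∀ R ∈ F, Hit V H R := by
  classical
  by_cases hp : Pierced F
  · obtain ⟨h, hh⟩ := hp
    exact ⟨[], [h, h + 1], by simp, by simp, hh⟩
  have hex : ∃ b, ¬ Pierced {R ∈ F | R.x₂ ≤ b} := by
    refine ⟨n, fun ⟨h, hh⟩ => hp ⟨h, fun R hR => hh R ⟨hR, hn R hR⟩⟩⟩
  set b := Nat.find hex with hb
  have hb0 : b ≠ 0 := by
    intro h0
    have := Nat.find_spec hex
    rw [← hb, h0] at this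
    refine this ⟨0, fun R hR => ?_⟩
    have h1 := (hF R hR.1).1
    have h2 := hR.2
    omega
  have hleft : Pierced {R ∈ F | R.x₂ ≤ b - 1} := by
    by_contra h
    have := Nat.find_min' hex h
    omega
  have hright : Pierced {R ∈ F | b ≤ R.x₁} := by
    refine (pierced_or_pierced (A := {R ∈ F | R.x₂ ≤ b}) (fun R hR => hF R hR.1)
      (fun R hR => hF R hR.1) ?_).resolve_left (Nat.find_spec hex)
    intro R hR S hS
    by_contra hc
    have hRS : Indep R S := ⟨Or.inl (hR.2.trans hS.2), by omega⟩
    have hne : R ≠ S := by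
      rintro rfl
      have := (hF R hR.1).1
      have := hR.2
      have := hS.2
      omega
    refine h2 ⟨{R, S}, Finset.card_pair hne, ?_, ?_⟩
    · simp only [Finset.mem_insert, Finset.mem_singleton]
      rintro _ (rfl | rfl)
      exacts [hR.1, hS.1]
    · rw [Finset.coe_pair]
      exact Set.pairwise_pair.2 fun _ => ⟨hRS, hRS.symm⟩
  obtain ⟨h, hh⟩ := hleft
  obtain ⟨h', hh'⟩ := hright
  refine ⟨[b - 1, b], [h, h + 1, h', h' + 1], by simp, by simp, fun R hR => ?_⟩
  have ht := (hF R hR).1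
  by_cases h1 : R.x₂ ≤ b - 1
  · exact (hh R ⟨hR, h1⟩).mono (by simp) (by simp)
  by_cases h2 : b ≤ R.x₁
  · exact (hh' R ⟨hR, h2⟩).mono (by simp) (by simp)
  left
  by_cases h3 : R.x₁ = b - 1
  · exact ⟨b, by simp, by omega, by omega⟩
  · exact ⟨b - 1, by simp, by omega, by omega⟩

/-- A family of rectangles without `k + 1` pairwise independent members is hit by a number of
lines that is bounded in terms of `k` (Gyárfás and Lehel). -/
theorem exists_lines (k : ℕ) : ∃ g : ℕ, ∀ (F : Set Rect) (n : ℕ), (∀ R ∈ F, R.Thick) →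
    (∀ R ∈ F, R.x₂ ≤ n) → ¬ HasIndep F (k + 1) →
    ∃ V H : List ℕ, V.length ≤ g ∧ H.length ≤ g ∧ ∀ R ∈ F, Hit V H R := by
  classical
  induction k with
  | zero =>
    refine ⟨0, fun F n _ _ h => ⟨[], [], le_rfl, le_rfl, fun R hR => (h ?_).elim⟩⟩
    exact ⟨{R}, by simp, by simpa using hR, by simp⟩
  | succ k ih =>
    rcases Nat.eq_zero_or_pos k with rfl | hk
    · exact ⟨4, fun F n hF hn h => exists_lines_of_not_hasIndep_two hF hn h⟩
    obtain ⟨g, hg⟩ := ih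
    -- The terms account for the rectangles to the left of the sweep line, the horizontal edges of
    -- the `k + 1` members of `s`, the families confined to the strip of one member of `s`, and the
    -- two lines at `b`.
    refine ⟨g + 2 * (k + 1) + (k + 1) * 4 + 2, fun F n hF hn h => ?_⟩
    by_cases hK : HasIndep F (k + 1)
    swap
    · obtain ⟨V, H, h1, h2, h3⟩ := hg F n hF hn hK
      exact ⟨V, H, by omega, by omega, h3⟩
    have hex : ∃ b, HasIndep {R ∈ F | R.x₂ ≤ b} (k + 1) := by
      obtain ⟨s, h1, h2, h3⟩ := hK
      exact ⟨n, s, h1, fun R hR => ⟨h2 R hR, hn R (h2 R hR)⟩, h3⟩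
    set b := Nat.find hex with hb
    obtain ⟨s, hs1, hs2, hs3⟩ := Nat.find_spec hex
    rw [← hb] at hs2
    have hb0 : b ≠ 0 := by
      obtain ⟨Q, hQ⟩ : s.Nonempty := by rw [← Finset.card_pos]; omega
      have h1 := (hF Q (hs2 Q hQ).1).1
      have h2 := (hs2 Q hQ).2
      omega
    obtain ⟨V, H, hV, hH, hVH⟩ := hg {R ∈ F | R.x₂ ≤ b - 1} n (fun R hR => hF R hR.1)
      (fun R hR => hn R hR.1) fun hc => by have := Nat.find_min' hex hc; omega
    have hright : ∀ Q : Rect, ∃ V H : List ℕ, V.length ≤ 4 ∧ H.length ≤ 4 ∧ (Q ∈ s →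
        ∀ R ∈ {R ∈ F | b ≤ R.x₁ ∧ Q.y₁ ≤ R.y₁ ∧ R.y₂ ≤ Q.y₂}, Hit V H R) := by
      intro Q
      by_cases hQ : Q ∈ s
      swap
      · exact ⟨[], [], by simp, by simp, fun h => absurd h hQ⟩
      -- Two independent rectangles in the strip of `Q` could replace `Q` in `s` and give `k + 2`
      -- independent ones.
      have hQ2 : ¬ HasIndep {R ∈ F | b ≤ R.x₁ ∧ Q.y₁ ≤ R.y₁ ∧ R.y₂ ≤ Q.y₂} 2 := by
        rintro ⟨t, ht1, ht2, ht3⟩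
        have hts : ∀ R ∈ t, ∀ S ∈ s.erase Q, Indep R S := by
          intro R hR S hS
          obtain ⟨hSQ, hS⟩ := Finset.mem_erase.1 hS
          obtain ⟨-, h1, h2, h3⟩ := ht2 R hR
          have h4 := (hs2 S hS).2
          have h5 := (hs3 hS hQ hSQ).2
          exact ⟨Or.inr (by omega), by omega⟩
        refine h ⟨t ∪ s.erase Q, ?_, ?_, ?_⟩
        · rw [Finset.card_union_of_disjoint, ht1, Finset.card_erase_of_mem hQ, hs1]
          · omega
          · refine Finset.disjoint_left.2 fun R hR hR' => ?_
            have h1 := (hts R hR R hR').1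
            have h2 := (hF R (ht2 R hR).1).1
            omega
        · intro R hR
          rcases Finset.mem_union.1 hR with hR | hR
          · exact (ht2 R hR).1
          · exact (hs2 R (Finset.mem_of_mem_erase hR)).1
        · rw [Finset.coe_union, Set.pairwise_union]
          refine ⟨ht3, hs3.mono (Finset.coe_subset.2 (Finset.erase_subset _ _)), ?_⟩
          intro R hR S hS _
          exact ⟨hts R hR S hS, (hts R hR S hS).symm⟩
      obtain ⟨V, H, h1, h2, h3⟩ := exists_lines_of_not_hasIndep_two (n := n)
        (fun R hR => hF R hR.1) (fun R hR => hn R hR.1) hQ2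
      exact ⟨V, H, h1, h2, fun _ => h3⟩
    choose V' H' hV' hH' hVH' using hright
    have hlen : ∀ W : Rect → List ℕ, (∀ Q, (W Q).length ≤ 4) →
        (s.toList.flatMap W).length ≤ (k + 1) * 4 := by
      intro W hW
      rw [List.length_flatMap]
      refine (List.sum_le_card_nsmul _ 4 ?_).trans (by simp [hs1])
      intro x hx
      obtain ⟨Q, -, rfl⟩ := List.mem_map.1 hx
      exact hW Q
    refine ⟨V ++ s.toList.flatMap V' ++ [b - 1, b],
      H ++ s.toList.map y₁ ++ s.toList.map y₂ ++ s.toList.flatMap H', ?_, ?_, fun R hR => ?_⟩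
    · have := hlen V' hV'
      simp only [List.length_append, List.length_cons, List.length_nil]
      omega
    · have := hlen H' hH'
      simp only [List.length_append, List.length_map, Finset.length_toList, hs1]
      omega
    have ht := (hF R hR).1
    by_cases h1 : R.x₂ ≤ b - 1
    · refine (hVH R ⟨hR, h1⟩).mono ?_ ?_ <;> intro x hx <;> simp [hx]
    by_cases h2 : b ≤ R.x₁
    -- Otherwise `R` could be added to `s`. As `R` lies to the right of `Q`, their vertical
    -- projections overlap: an edge of `Q` cuts `R`, or `R` stays within the strip of `Q`.
    · obtain ⟨Q, hQ, hQR⟩ : ∃ Q ∈ s, ¬ Indep R Q := by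
        by_contra! hc
        refine h ⟨insert R s, ?_, ?_, ?_⟩
        · rw [Finset.card_insert_of_notMem, hs1]
          intro hRs
          have := (hs2 R hRs).2
          omega
        · intro S hS
          rcases Finset.mem_insert.1 hS with rfl | hS
          exacts [hR, (hs2 S hS).1]
        · rw [Finset.coe_insert]
          exact hs3.insert fun S hS _ => ⟨hc S hS, (hc S hS).symm⟩
      have hQ2 := (hs2 Q hQ).2
      have hy : R.y₁ < Q.y₂ ∧ Q.y₁ < R.y₂ := by
        by_contra hc
        exact hQR ⟨Or.inr (by omega), by omega⟩
      by_cases h3 : R.y₁ < Q.y₁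
      · exact Or.inr ⟨Q.y₁, by simp only [List.mem_append, List.mem_map, Finset.mem_toList]
                               exact Or.inl (Or.inl (Or.inr ⟨Q, hQ, rfl⟩)), h3, hy.2⟩
      by_cases h4 : Q.y₂ < R.y₂
      · exact Or.inr ⟨Q.y₂, by simp only [List.mem_append, List.mem_map, Finset.mem_toList]
                               exact Or.inl (Or.inr ⟨Q, hQ, rfl⟩), hy.1, h4⟩
      refine (hVH' Q hQ R ⟨hR, h2, by omega, by omega⟩).mono ?_ ?_
      · intro x hx
        simp only [List.mem_append, List.mem_flatMap, Finset.mem_toList]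
        exact Or.inl (Or.inr ⟨Q, hQ, hx⟩)
      · intro x hx
        simp only [List.mem_append, List.mem_flatMap, Finset.mem_toList]
        exact Or.inr ⟨Q, hQ, hx⟩
    left
    by_cases h3 : R.x₁ = b - 1
    · exact ⟨b, by simp, by omega, by omega⟩
    · exact ⟨b - 1, by simp, by omega, by omega⟩

/-! ### Monotone sequences of independent rectangles. -/

/-- `S` lies to the right of and above `R`. -/
def Up (R S : Rect) : Prop := R.x₂ ≤ S.x₁ ∧ R.y₂ ≤ S.y₁

/-- `S` lies to the right of and below `R`. -/
def Down (R S : Rect) : Prop := R.x₂ ≤ S.x₁ ∧ S.y₂ ≤ R.y₁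

/-- The members of `s` form an increasing or decreasing sequence, according to `r`. -/
def IsChain (r : Rect → Rect → Prop) (s : Finset Rect) : Prop :=
  ∀ R ∈ s, ∀ S ∈ s, R ≠ S → r R S ∨ r S R

lemma IsChain.mono {r : Rect → Rect → Prop} {s t : Finset Rect} (h : IsChain r s) (hts : t ⊆ s) :
    IsChain r t := fun R hR S hS => h R (hts hR) S (hts hS)

/-- The Erdős–Szekeres theorem for independent rectangles. -/
theorem exists_chain (b : ℕ) (a : ℕ) : ∀ s : Finset Rect, (∀ R ∈ s, R.Thick) →
    (s : Set Rect).Pairwise Indep → a * b < s.card →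
    (∃ t ⊆ s, a < t.card ∧ IsChain Up t) ∨ ∃ t ⊆ s, b < t.card ∧ IsChain Down t := by
  classical
  induction a with
  | zero =>
    intro s _ _ h
    exact Or.inl ⟨{(Finset.card_pos.1 (by omega : 0 < s.card)).choose}, by
      simpa using (Finset.card_pos.1 (by omega : 0 < s.card)).choose_spec, by simp, by
      intro R hR S hS hne
      simp only [Finset.mem_singleton] at hR hS
      exact absurd (hR.trans hS.symm) hne⟩
  | succ a ih =>
    intro s hs hp hc
    -- The minimal members for `Up` form a decreasing sequence. If there are at most `b` of them,
    -- remove them: an increasing sequence among the others is extended at its lower end by one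
    -- member of `s`.
    set M := s.filter fun R => ∀ Q ∈ s, ¬ Up Q R with hM
    have hMs : M ⊆ s := Finset.filter_subset _ _
    by_cases hMb : b < M.card
    · refine Or.inr ⟨M, hMs, hMb, fun R hR S hS hne => ?_⟩
      have h1 := (Finset.mem_filter.1 hR).2 S (hMs hS)
      have h2 := (Finset.mem_filter.1 hS).2 R (hMs hR)
      have h3 := hp (hMs hR) (hMs hS) hne
      unfold Up Indep Down at *
      omega
    have hcard : a * b < (s \ M).card := by
      rw [Finset.card_sdiff_of_subset hMs]
      have : (a + 1) * b = a * b + b := by ring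
      omega
    rcases ih (s \ M) (fun R hR => hs R (Finset.sdiff_subset hR))
      (hp.mono (Finset.coe_subset.2 Finset.sdiff_subset)) hcard with
      ⟨t, hts, hat, ht⟩ | ⟨t, hts, hbt, ht⟩
    · left
      obtain ⟨R, hR, hmin⟩ := t.exists_min_image x₁ (Finset.card_pos.1 (by omega))
      obtain ⟨hRs, hRM⟩ := Finset.mem_sdiff.1 (hts hR)
      obtain ⟨Q, hQ, hQR⟩ : ∃ Q ∈ s, Up Q R := by
        by_contra! hcon
        exact hRM (Finset.mem_filter.2 ⟨hRs, hcon⟩)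
      have hup : ∀ S ∈ t, Up Q S := by
        intro S hS
        by_cases hne : R = S
        · rwa [← hne]
        have h1 := hmin S hS
        have h2 := (hs R hRs).1
        have h3 := (hs R hRs).2
        have h4 := (hs S (Finset.sdiff_subset (hts hS))).1
        rcases ht R hR S hS hne with h | h <;> unfold Up at * <;> omega
      have hQt : Q ∉ t := by
        intro hQt
        have h1 := (hup Q hQt).1
        have h2 := (hs Q hQ).1
        omega
      refine ⟨insert Q t, ?_, by rw [Finset.card_insert_of_notMem hQt]; omega, ?_⟩
      · exact Finset.insert_subset hQ (hts.trans Finset.sdiff_subset)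
      · intro A hA B hB hne
        rcases Finset.mem_insert.1 hA with rfl | hA' <;>
          rcases Finset.mem_insert.1 hB with rfl | hB'
        · exact absurd rfl hne
        · exact Or.inl (hup B hB')
        · exact Or.inr (hup A hA')
        · exact ht A hA' B hB' hne
    · exact Or.inr ⟨t, hts.trans Finset.sdiff_subset, hbt, ht⟩

end Rect

/-! ### Direct sums -/

/-- The direct sum `σ ⊕ τ`. -/
def dsum (σ τ : FinPerm) : FinPerm :=
  ⟨σ.1 + τ.1, finSumFinEquiv.permCongr (Equiv.sumCongr σ.2 τ.2)⟩

lemma dsum_castAdd (σ τ : FinPerm) (i : Fin σ.1) :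
    (dsum σ τ).2 (Fin.castAdd τ.1 i) = Fin.castAdd τ.1 (σ.2 i) := by
  change finSumFinEquiv (Equiv.sumCongr σ.2 τ.2 (finSumFinEquiv.symm (Fin.castAdd τ.1 i))) = _
  simp

lemma dsum_natAdd (σ τ : FinPerm) (i : Fin τ.1) :
    (dsum σ τ).2 (Fin.natAdd σ.1 i) = Fin.natAdd σ.1 (τ.2 i) := by
  change finSumFinEquiv (Equiv.sumCongr σ.2 τ.2 (finSumFinEquiv.symm (Fin.natAdd σ.1 i))) = _
  simp

/-- The entry of `π` in position `i`, as a natural number. -/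
def entry (π : FinPerm) (i : ℕ) : ℕ := if h : i < π.1 then π.2 ⟨i, h⟩ else 0

lemma entry_val (π : FinPerm) (i : Fin π.1) : entry π i = π.2 i := dif_pos i.isLt

lemma ext_entry {π ρ : FinPerm} (h : π.1 = ρ.1) (he : ∀ i < π.1, entry π i = entry ρ i) :
    π = ρ := by
  obtain ⟨n, p⟩ := π
  obtain ⟨m, r⟩ := ρ
  obtain rfl : n = m := h
  congr 1
  ext i
  have := he i i.isLt
  have h1 := entry_val ⟨n, p⟩ i
  have h2 := entry_val ⟨n, r⟩ i
  exact h1.symm.trans (this.trans h2)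

lemma entry_dsum_left (σ τ : FinPerm) {i : ℕ} (hi : i < σ.1) :
    entry (dsum σ τ) i = entry σ i := by
  have h1 := entry_val (dsum σ τ) (Fin.castAdd τ.1 ⟨i, hi⟩)
  rw [dsum_castAdd] at h1
  have h2 := entry_val σ ⟨i, hi⟩
  simp only [Fin.val_castAdd] at h1 h2
  rw [h1, h2]

lemma entry_dsum_right (σ τ : FinPerm) {i : ℕ} (hi : i < τ.1) :
    entry (dsum σ τ) (σ.1 + i) = σ.1 + entry τ i := by
  have h1 := entry_val (dsum σ τ) (Fin.natAdd σ.1 ⟨i, hi⟩)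
  rw [dsum_natAdd] at h1
  have h2 := entry_val τ ⟨i, hi⟩
  simp only [Fin.val_natAdd] at h1 h2
  rw [h1, h2]

/-- If `σ` were shorter, an inversion of `σ'` would cross the cut after `σ`, where the sum `σ ⊕ τ`
has none. -/
lemma not_length_lt_of_dsum_eq {σ τ σ' τ' : FinPerm} (h : dsum σ τ = dsum σ' τ') (h0 : 0 < σ.1)
    (h' : Indec σ') : ¬ σ.1 < σ'.1 := by
  intro hlt
  obtain ⟨i, j, hi, hj, hji⟩ := h'.exists_cut h0 hlt
  have h1 := entry_dsum_left σ' τ' i.isLt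
  have h2 := entry_dsum_left σ' τ' j.isLt
  rw [← h, entry_val] at h1 h2
  rw [entry_dsum_left σ τ hi] at h1
  have h3 := entry_val σ ⟨i, hi⟩
  have h4 := (σ.2 ⟨i, hi⟩).isLt
  have hlen : σ.1 + τ.1 = σ'.1 + τ'.1 := congrArg Sigma.fst h
  have h5 := entry_dsum_right σ τ (i := j - σ.1) (by have := j.isLt; omega)
  rw [show σ.1 + (j - σ.1) = (j : ℕ) by omega, h2] at h5
  have : (σ'.2 j : ℕ) < σ'.2 i := hji
  simp only at h3
  omega

/-- The first sum indecomposable component is unique. -/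
lemma dsum_injective {σ τ σ' τ' : FinPerm} (h : dsum σ τ = dsum σ' τ') (h0 : 0 < σ.1)
    (h0' : 0 < σ'.1) (hσ : Indec σ) (hσ' : Indec σ') : σ = σ' ∧ τ = τ' := by
  have h1 := not_length_lt_of_dsum_eq h h0 hσ'
  have h2 := not_length_lt_of_dsum_eq h.symm h0' hσ
  have hlen : σ.1 + τ.1 = σ'.1 + τ'.1 := congrArg Sigma.fst h
  have h3 : σ.1 = σ'.1 := by omega
  constructor
  · refine ext_entry h3 fun i hi => ?_
    rw [← entry_dsum_left σ τ hi, h, entry_dsum_left σ' τ' (by omega)]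
  · refine ext_entry (by omega) fun i hi => ?_
    have h4 := entry_dsum_right σ τ hi
    rw [h, h3, entry_dsum_right σ' τ' (by omega)] at h4
    omega

/-! ### Counting direct sums of sum indecomposables. -/

/-- The sums of members of `l`. -/
inductive SumOf (l : List FinPerm) : FinPerm → Prop
  | nil : SumOf l ⟨0, Equiv.refl _⟩
  | cons {τ ρ : FinPerm} : τ ∈ l → SumOf l ρ → SumOf l (dsum τ ρ)

lemma finite_sumOf (l : List FinPerm) (n : ℕ) : {ρ | SumOf l ρ ∧ ρ.1 = n}.Finite := by
  refine (Set.finite_range fun p : Equiv.Perm (Fin n) => (⟨n, p⟩ : FinPerm)).subset ?_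
  rintro ⟨m, p⟩ ⟨-, rfl⟩
  exact ⟨p, rfl⟩

/-- The number of sums of members of `l` that have length `n`. -/
noncomputable def numSums (l : List FinPerm) (n : ℕ) : ℕ := {ρ | SumOf l ρ ∧ ρ.1 = n}.ncard

lemma exists_sumOf {l : List FinPerm} (h : p1 ∈ l) (n : ℕ) : ∃ ρ, SumOf l ρ ∧ ρ.1 = n := by
  induction n with
  | zero => exact ⟨_, SumOf.nil, rfl⟩
  | succ n ih =>
    obtain ⟨ρ, hρ, hn⟩ := ih
    refine ⟨_, SumOf.cons h hρ, ?_⟩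
    change 1 + ρ.1 = n + 1
    omega

lemma one_le_numSums {l : List FinPerm} (h : p1 ∈ l) (n : ℕ) : 1 ≤ numSums l n :=
  (Set.ncard_pos (finite_sumOf l n)).2 (exists_sumOf h n)

/-- Sort the sums by their first summand: prepending a fixed `τ` is injective, and different `τ`
give disjoint sets, by `dsum_injective`. -/
lemma sum_numSums_le {l : List FinPerm} (hl : l.Nodup) (h : ∀ τ ∈ l, 0 < τ.1 ∧ Indec τ) {n : ℕ}
    (hn : ∀ τ ∈ l, τ.1 ≤ n) : (l.map fun τ => numSums l (n - τ.1)).sum ≤ numSums l n := by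
  classical
  rw [← List.sum_toFinset _ hl]
  set A : ℕ → Finset FinPerm := fun n => (finite_sumOf l n).toFinset with hA
  have hcard : ∀ n, numSums l n = (A n).card := fun n => Set.ncard_eq_toFinset_card _ _
  have hmem : ∀ n ρ, ρ ∈ A n ↔ SumOf l ρ ∧ ρ.1 = n := fun n ρ => by simp [hA]
  have hdisj : ∀ τ ∈ l.toFinset, ∀ τ' ∈ l.toFinset, τ ≠ τ' →
      Disjoint ((A (n - τ.1)).image (dsum τ)) ((A (n - τ'.1)).image (dsum τ')) := by
    intro τ hτ τ' hτ' hne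
    rw [List.mem_toFinset] at hτ hτ'
    refine Finset.disjoint_left.2 fun ρ h1 h2 => hne ?_
    obtain ⟨ρ₁, -, rfl⟩ := Finset.mem_image.1 h1
    obtain ⟨ρ₂, -, h3⟩ := Finset.mem_image.1 h2
    exact (dsum_injective h3.symm (h τ hτ).1 (h τ' hτ').1 (h τ hτ).2 (h τ' hτ').2).1
  calc ∑ τ ∈ l.toFinset, numSums l (n - τ.1)
      = ∑ τ ∈ l.toFinset, ((A (n - τ.1)).image (dsum τ)).card := by
        refine Finset.sum_congr rfl fun τ hτ => ?_
        rw [List.mem_toFinset] at hτ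
        rw [Finset.card_image_of_injective, hcard]
        exact fun ρ ρ' he => (dsum_injective he (h τ hτ).1 (h τ hτ).1 (h τ hτ).2 (h τ hτ).2).2
    _ = (l.toFinset.biUnion fun τ => (A (n - τ.1)).image (dsum τ)).card :=
        (Finset.card_biUnion hdisj).symm
    _ ≤ (A n).card := by
        refine Finset.card_le_card fun ρ hρ => ?_
        obtain ⟨τ, hτ, hρ⟩ := Finset.mem_biUnion.1 hρ
        obtain ⟨ρ', hρ', rfl⟩ := Finset.mem_image.1 hρ
        rw [List.mem_toFinset] at hτ
        obtain ⟨h1, h2⟩ := (hmem _ _).1 hρ'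
        refine (hmem _ _).2 ⟨SumOf.cons hτ h1, ?_⟩
        have := hn τ hτ
        change τ.1 + ρ'.1 = n
        omega
    _ = numSums l n := (hcard n).symm

/-- The number of sums grows at least like `t⁻¹ ^ n`. -/
lemma pow_le_numSums {t : ℝ} (ht0 : 0 < t) (ht1 : t ≤ 1) {l : List FinPerm} (h1 : p1 ∈ l)
    (hl : l.Nodup) (h : ∀ τ ∈ l, 0 < τ.1 ∧ τ.1 ≤ 6 ∧ Indec τ)
    (hsum : 1 ≤ (l.map fun τ => t ^ τ.1).sum) (n : ℕ) : t ^ 6 ≤ numSums l n * t ^ n := by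
  induction n using Nat.strong_induction_on with
  | _ n ih =>
    -- The recurrence needs all members of `l` to have length at most `n`. Below 6 it is enough that
    -- some sum of length `n` exists, which is why `p1` is required in `l`.
    rcases lt_or_ge n 6 with hn | hn
    · have h2 : (1 : ℝ) ≤ numSums l n := by exact_mod_cast one_le_numSums h1 n
      calc t ^ 6 ≤ t ^ n := pow_le_pow_of_le_one ht0.le ht1 hn.le
        _ ≤ numSums l n * t ^ n := le_mul_of_one_le_left (by positivity) h2
    · have h2 := sum_numSums_le hl (fun τ hτ => ⟨(h τ hτ).1, (h τ hτ).2.2⟩) (n := n)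
        fun τ hτ => (h τ hτ).2.1.trans hn
      have h3 : ((l.map fun τ => (numSums l (n - τ.1) : ℝ)).sum) ≤ numSums l n := by
        have : ((l.map fun τ => numSums l (n - τ.1)).sum : ℝ) =
            (l.map fun τ => (numSums l (n - τ.1) : ℝ)).sum := by
          push_cast [List.map_map]
          rfl
        rw [← this]
        exact_mod_cast h2
      calc t ^ 6 ≤ t ^ 6 * (l.map fun τ => t ^ τ.1).sum :=
            le_mul_of_one_le_right (by positivity) hsum
        _ = (l.map fun τ => t ^ 6 * t ^ τ.1).sum := (List.sum_map_mul_left ..).symm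
        _ ≤ (l.map fun τ => numSums l (n - τ.1) * t ^ n).sum := by
            refine List.sum_le_sum fun τ hτ => ?_
            obtain ⟨h4, h5, -⟩ := h τ hτ
            have h6 := ih (n - τ.1) (by omega)
            calc t ^ 6 * t ^ τ.1 ≤ numSums l (n - τ.1) * t ^ (n - τ.1) * t ^ τ.1 := by gcongr
              _ = numSums l (n - τ.1) * t ^ n := by
                rw [mul_assoc, ← pow_add]
                congr 2
                omega
        _ = (l.map fun τ => (numSums l (n - τ.1) : ℝ)).sum * t ^ n := List.sum_map_mul_right ..
        _ ≤ numSums l n * t ^ n := by gcongr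

lemma numSums_le_speed {C : Set FinPerm} {l : List FinPerm} (h : ∀ ρ, SumOf l ρ → ρ ∈ C) (n : ℕ) :
    numSums l n ≤ speed C n := by
  unfold numSums speed
  rw [← Set.ncard_image_of_injective {σ : Equiv.Perm (Fin n) | (⟨n, σ⟩ : FinPerm) ∈ C}
    (f := fun σ => (⟨n, σ⟩ : FinPerm)) (fun σ τ h => by simpa using h)]
  refine Set.ncard_le_ncard ?_ (Set.toFinite _)
  rintro ⟨m, p⟩ ⟨h1, rfl⟩
  exact ⟨p, h _ h1, rfl⟩

/-- A class that contains all sums of a rich list of permutations grows at least like `t⁻¹ ^ n`. -/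
lemma le_lowerGrowthRate {t : ℝ} (ht0 : 0 < t) {C : Set FinPerm}
    (h : ∀ n, t ^ 6 ≤ speed C n * t ^ n) : ENNReal.ofReal t⁻¹ ≤ lowerGrowthRate C := by
  -- The constant factor `t ^ 6` disappears under the `n`-th root.
  have hlim : Filter.Tendsto (fun n : ℕ => ENNReal.ofReal ((t ^ 6) ^ (1 / (n : ℝ)) * t⁻¹))
      Filter.atTop (nhds (ENNReal.ofReal t⁻¹)) := by
    refine ENNReal.tendsto_ofReal ?_
    have h1 : Filter.Tendsto (fun n : ℕ => (t ^ 6) ^ (1 / (n : ℝ))) Filter.atTop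
        (nhds ((t ^ 6) ^ (0 : ℝ))) :=
      Filter.Tendsto.rpow tendsto_const_nhds tendsto_one_div_atTop_nhds_zero_nat
        (Or.inl (by positivity))
    simpa using h1.mul_const t⁻¹
  rw [← hlim.liminf_eq]
  refine Filter.liminf_le_liminf ?_
  filter_upwards [Filter.eventually_gt_atTop 0] with n hn
  have hn' : (n : ℝ) ≠ 0 := by positivity
  have h1 : t ^ 6 * t⁻¹ ^ n ≤ speed C n := by
    rw [inv_pow, ← div_eq_mul_inv, div_le_iff₀ (by positivity)]
    exact h n
  have h2 : (t ^ 6) ^ (1 / (n : ℝ)) * t⁻¹ = (t ^ 6 * t⁻¹ ^ n) ^ (1 / (n : ℝ)) := by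
    rw [Real.mul_rpow (by positivity) (by positivity), ← Real.rpow_natCast t⁻¹,
      ← Real.rpow_mul (by positivity), mul_one_div_cancel hn', Real.rpow_one]
  rw [h2, ← ENNReal.ofReal_natCast, ENNReal.ofReal_rpow_of_nonneg (by positivity) (by positivity)]
  exact ENNReal.ofReal_le_ofReal (Real.rpow_le_rpow (by positivity) h1 (by positivity))

/-! ### Wreath closures -/

lemma isPermClass_wreathClosure (X : Set FinPerm) : IsPermClass (wreathClosure X) :=
  fun π hπ σ h D hD => hD.1 π (hπ D hD) σ h

lemma isWreathClosed_wreathClosure (X : Set FinPerm) : IsWreathClosed (wreathClosure X) :=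
  fun σ hσ α hα π h D hD => hD.2.1 σ (hσ D hD) α (fun k => hα k D hD) π h

lemma subset_wreathClosure (X : Set FinPerm) : X ⊆ wreathClosure X :=
  fun _ hπ _ hD => hD.2.2 hπ

lemma IsPatternAt.length_lt {σ π : FinPerm} {S : Set (Fin π.1)} (h : IsPatternAt σ π S)
    (hS : S ≠ Set.univ) : σ.1 < π.1 := by
  obtain ⟨f, hf, -⟩ := h
  have := Fintype.card_lt_of_injective_not_surjective f f.injective fun hs =>
    hS (hf ▸ hs.range_eq)
  simpa using this

lemma isPatternAt_singleton (π : FinPerm) (x : Fin π.1) : IsPatternAt p1 π {x} := by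
  have hsub : ∀ i j : Fin 1, i = j := fun i j => Subsingleton.elim i j
  refine ⟨OrderEmbedding.ofStrictMono (fun _ : Fin 1 => x) fun i j h => ?_, ?_, ?_⟩
  · exact absurd (hsub i j) h.ne
  · exact Set.range_const (ι := Fin 1)
  · intro (i : Fin 1) (j : Fin 1)
    rw [hsub i j]
    exact iff_of_false (lt_irrefl _) (lt_irrefl _)

/-- A permutation with a nontrivial interval is an inflation of smaller patterns. -/
lemma IsInterval.exists_isInflation {π : FinPerm} {I : Set (Fin π.1)} (hI : IsInterval π I)
    {x₀ : Fin π.1} (hx₀ : x₀ ∈ I) {σ β : FinPerm} (hσ : IsPatternAt σ π (insert x₀ Iᶜ))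
    (hβ : IsPatternAt β π I) :
    ∃ α : Fin σ.1 → FinPerm, (∀ k, α k = β ∨ α k = p1) ∧ IsInflation π σ α := by
  classical
  obtain ⟨f, hf, hfv⟩ := hσ
  -- Collapse `I` to its representative `x₀`; the block map of the inflation is this collapse read
  -- through `f`.
  set col : Fin π.1 → Fin π.1 := fun i => if i ∈ I then x₀ else i with hcol
  have col_in : ∀ i ∈ I, col i = x₀ := fun i hi => if_pos hi
  have col_out : ∀ i ∉ I, col i = i := fun i hi => if_neg hi
  have hb : ∀ i, ∃ k, f k = col i := by
    intro i
    have : col i ∈ Set.range f := by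
      rw [hf]
      by_cases hi : i ∈ I
      · rw [col_in i hi]; exact Set.mem_insert _ _
      · rw [col_out i hi]; exact Set.mem_insert_of_mem _ hi
    exact this
  choose b hb using hb
  have hfk : ∀ k, f k = x₀ ∨ f k ∉ I := fun k => by
    have : f k ∈ insert x₀ Iᶜ := hf ▸ Set.mem_range_self k
    exact this
  refine ⟨fun k => if f k = x₀ then β else p1, fun k => ?_, fun k => ?_, b, fun i j hij => ?_,
    fun k => ?_, fun i j hij => ?_⟩
  · dsimp only
    split_ifs <;> simp
  · dsimp only
    split_ifs
    · obtain ⟨g, hg, -⟩ := hβ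
      have : x₀ ∈ Set.range g := hg ▸ hx₀
      obtain ⟨y, -⟩ := this
      exact Nat.pos_of_ne_zero fun h => (Fin.cast h y).elim0
    · exact Nat.one_pos
  · rw [← f.le_iff_le, hb, hb]
    by_cases hi : i ∈ I <;> by_cases hj : j ∈ I
    · rw [col_in i hi, col_in j hj]
    · rw [col_in i hi, col_out j hj]
      exact not_lt.1 fun h => absurd ((hI j hj i hi x₀ hx₀).1.2 h) (not_lt.2 hij)
    · rw [col_out i hi, col_in j hj]
      have hne : i ≠ j := by rintro rfl; exact hi hj
      exact ((hI i hi j hj x₀ hx₀).1.1 (lt_of_le_of_ne hij hne)).le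
    · rwa [col_out i hi, col_out j hj]
  · dsimp only
    split_ifs with hk
    · convert hβ using 1
      ext i
      change b i = k ↔ i ∈ I
      rw [← f.injective.eq_iff, hb, hk]
      refine ⟨fun h => ?_, col_in i⟩
      by_contra hi
      rw [col_out i hi] at h
      exact hi (h ▸ hx₀)
    · convert isPatternAt_singleton π (f k) using 1
      ext i
      change b i = k ↔ i = f k
      rw [← f.injective.eq_iff, hb]
      have hkI := (hfk k).resolve_left hk
      by_cases hi : i ∈ I
      · rw [col_in i hi]
        exact iff_of_false (fun h => hk h.symm) fun h => hkI (h ▸ hi)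
      · rw [col_out i hi]
  · rw [hfv, hb, hb]
    by_cases hi : i ∈ I <;> by_cases hj : j ∈ I
    · exact absurd (f.injective ((hb i).trans (((col_in i hi).trans (col_in j hj).symm).trans
        (hb j).symm))) hij
    · rw [col_in i hi, col_out j hj]
      have h1 := (hI j hj i hi x₀ hx₀).2
      have h2 : π.2 i ≠ π.2 j := fun h => hj (π.2.injective h ▸ hi)
      have h3 : π.2 x₀ ≠ π.2 j := fun h => hj (π.2.injective h ▸ hx₀)
      omega
    · rw [col_out i hi, col_in j hj]
      exact (hI i hi j hj x₀ hx₀).2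
    · rw [col_out i hi, col_out j hj]

/-- A permutation outside the wreath closure of `X` contains a simple one outside `X`. -/
theorem exists_isSimple_of_notMem_wreathClosure {X : Set FinPerm} (n : ℕ) : ∀ π : FinPerm,
    π.1 = n → π ∉ wreathClosure X → ∃ σ, IsSimple σ ∧ σ ∉ X ∧ Contained σ π := by
  induction n using Nat.strong_induction_on with
  | _ n ih =>
    rintro π rfl hπ
    by_cases hs : IsSimple π
    · exact ⟨π, hs, fun h => hπ (subset_wreathClosure X h), Contained.refl π⟩
    by_cases hall : ∀ ρ, Contained ρ π → ρ.1 < π.1 → ρ ∈ wreathClosure X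
    swap
    · push Not at hall
      obtain ⟨ρ, hρ, hlt, hmem⟩ := hall
      obtain ⟨σ, h1, h2, h3⟩ := ih _ hlt ρ rfl hmem
      exact ⟨σ, h1, h2, h3.trans hρ⟩
    exfalso
    unfold IsSimple at hs
    push Not at hs
    obtain ⟨I, hI, hsub, huniv⟩ := hs
    -- All smaller patterns lie in the wreath closure here, and a nontrivial interval makes `π` an
    -- inflation of such patterns.
    obtain ⟨x₀, hx₀, x₁, hx₁, hne⟩ := hsub
    obtain ⟨σ, hσ⟩ := exists_pattern π (insert x₀ Iᶜ)
    obtain ⟨β, hβ⟩ := exists_pattern π I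
    obtain ⟨α, hα, hinf⟩ := hI.exists_isInflation hx₀ hσ hβ
    have hσlt := hσ.length_lt fun h => by
      have : x₁ ∈ insert x₀ Iᶜ := h ▸ Set.mem_univ x₁
      rcases this with h | h
      exacts [hne h.symm, h hx₁]
    have h1lt : 1 < π.1 := by
      have := Fintype.one_lt_card_iff.2 ⟨x₀, x₁, hne⟩
      simpa using this
    refine hπ (isWreathClosed_wreathClosure X σ (hall σ hσ.contained hσlt) α (fun k => ?_) π hinf)
    rcases hα k with h | h <;> rw [h]
    · exact hall β hβ.contained (hβ.length_lt huniv)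
    · exact hall p1 (isPatternAt_singleton π x₀).contained h1lt

/-! ### Occurrences inside rectangles -/

/-- `σ` occurs in `π` inside the rectangle `R`. -/
def OccIn (σ π : FinPerm) (R : Rect) : Prop :=
  ∃ f, Occ σ π f ∧ ∀ i, f i ∈ cell π R.x₁ R.x₂ R.y₁ R.y₂

lemma OccIn.mono {σ τ π : FinPerm} {R : Rect} (h : OccIn τ π R) (hσ : Contained σ τ) :
    OccIn σ π R := by
  obtain ⟨f, hf, hR⟩ := h
  obtain ⟨g, hg⟩ := contained_iff.1 hσ
  exact ⟨f ∘ g, hf.comp hg, fun i => hR (g i)⟩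

lemma IsPatternAt.occIn {σ π : FinPerm} {R : Rect}
    (h : IsPatternAt σ π (cell π R.x₁ R.x₂ R.y₁ R.y₂)) : OccIn σ π R := by
  obtain ⟨f, hf, hr⟩ := h.exists_occ
  exact ⟨f, hf, fun i => hr ▸ Set.mem_range_self i⟩

/-- The mirror image of a rectangle in `[0, n) × [0, n)`. -/
def Rect.mirror (n : ℕ) (R : Rect) : Rect := ⟨n - R.x₂, n - R.x₁, R.y₁, R.y₂⟩

lemma OccIn.reverse {σ π : FinPerm} {R : Rect} (h : OccIn σ π R) :
    OccIn (reverse σ) (reverse π) (R.mirror π.1) := by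
  obtain ⟨f, hf, hR⟩ := h
  have key : ∀ v : Fin π.1, v ∈ cell π R.x₁ R.x₂ R.y₁ R.y₂ →
      π.1 - R.x₂ ≤ (v.rev : ℕ) ∧ (v.rev : ℕ) < π.1 - R.x₁ ∧ R.y₁ ≤ (π.2 v.rev.rev : ℕ) ∧
        (π.2 v.rev.rev : ℕ) < R.y₂ := by
    rintro v ⟨h1, h2, h3, h4⟩
    rw [Fin.rev_rev, Fin.val_rev]
    have h5 := v.isLt
    exact ⟨by omega, by omega, h3, h4⟩
  exact ⟨_, hf.reverse, fun i : Fin σ.1 => key _ (hR i.rev)⟩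

/-- Sums of permutations that occur in an increasing sequence of rectangles occur in `π`. -/
lemma SumOf.occ_of_isChain {l : List FinPerm} {π ρ : FinPerm} (hρ : SumOf l ρ)
    (hl : ∀ τ ∈ l, 0 < τ.1) : ∀ (s : Finset Rect) (x y : ℕ), (∀ R ∈ s, R.Thick) →
    Rect.IsChain Rect.Up s → (∀ R ∈ s, x ≤ R.x₁ ∧ y ≤ R.y₁) → ρ.1 ≤ s.card →
    (∀ R ∈ s, ∀ τ ∈ l, OccIn τ π R) →
    ∃ f, Occ ρ π f ∧ ∀ i, x ≤ (f i : ℕ) ∧ y ≤ (π.2 (f i) : ℕ) := by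
  classical
  induction hρ with
  | nil =>
    intro s x y _ _ _ _ _
    exact ⟨fun i : Fin 0 => i.elim0, ⟨fun i => Fin.elim0 i, fun i => Fin.elim0 i⟩,
      fun i => Fin.elim0 i⟩
  | @cons τ ρ hτ hρ ih =>
    intro s x y hs hc hxy hcard hocc
    have hcard : τ.1 + ρ.1 ≤ s.card := hcard
    have hτ0 := hl τ hτ
    -- The first summand goes into the leftmost rectangle, the others beyond its upper right corner.
    -- One rectangle per summand is used, and summands are nonempty, so `ρ.1` rectangles suffice.
    obtain ⟨R, hR, hmin⟩ := s.exists_min_image Rect.x₁ (Finset.card_pos.1 (by omega))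
    have hup : ∀ S ∈ s.erase R, R.x₂ ≤ S.x₁ ∧ R.y₂ ≤ S.y₁ := by
      intro S hS
      obtain ⟨hne, hS⟩ := Finset.mem_erase.1 hS
      rcases hc R hR S hS hne.symm with h | h
      · exact h
      · have h1 := hmin S hS
        have h2 := (hs S hS).1
        have h3 := h.1
        omega
    obtain ⟨g, hg, hgR⟩ := hocc R hR τ hτ
    obtain ⟨f, hf, hfR⟩ := ih (s.erase R) R.x₂ R.y₂ (fun S hS => hs S (Finset.mem_of_mem_erase hS))
      (hc.mono (Finset.erase_subset _ _)) hup (by rw [Finset.card_erase_of_mem hR]; omega)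
      fun S hS => hocc S (Finset.mem_of_mem_erase hS)
    have hxyR := hxy R hR
    have hthick := hs R hR
    have hgf : ∀ i j, g i < f j ∧ π.2 (g i) < π.2 (f j) := fun i j => by
      obtain ⟨h1, h2, h3, h4⟩ := hgR i
      obtain ⟨h5, h6⟩ := hfR j
      exact ⟨Fin.lt_def.2 (by omega), Fin.lt_def.2 (by omega)⟩
    have hl' : ∀ i : Fin τ.1, Fin.append g f (Fin.castAdd ρ.1 i) = g i := Fin.append_left g f
    have hr' : ∀ i : Fin ρ.1, Fin.append g f (Fin.natAdd τ.1 i) = f i := Fin.append_right g f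
    refine ⟨Fin.append g f, ⟨fun i j => ?_, fun i j => ?_⟩, fun i => ?_⟩
    · change Fin (τ.1 + ρ.1) at i j
      refine Fin.addCases (fun i => ?_) (fun i => ?_) i <;>
        refine Fin.addCases (fun j => ?_) (fun j => ?_) j <;> intro hij
      · rw [hl', hl']
        exact hg.1 hij
      · rw [hl', hr']
        exact (hgf i j).1
      · have := Fin.lt_def.1 hij
        simp only [Fin.val_natAdd, Fin.val_castAdd] at this
        have := j.isLt
        omega
      · rw [hr', hr']
        have := Fin.lt_def.1 hij
        simp only [Fin.val_natAdd] at this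
        exact hf.1 (Fin.lt_def.2 (by omega))
    · change Fin (τ.1 + ρ.1) at i j
      refine Fin.addCases (fun i => ?_) (fun i => ?_) i <;>
        refine Fin.addCases (fun j => ?_) (fun j => ?_) j
      · rw [hl', hl', dsum_castAdd, dsum_castAdd, ← hg.2]
        rfl
      · rw [hl', hr', dsum_castAdd, dsum_natAdd]
        refine iff_of_true (Fin.lt_def.2 ?_) (hgf i j).2
        have := (τ.2 i).isLt
        simp only [Fin.val_natAdd, Fin.val_castAdd]
        omega
      · rw [hl', hr', dsum_castAdd, dsum_natAdd]
        refine iff_of_false (fun h => ?_) (hgf j i).2.not_gt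
        have h1 := Fin.lt_def.1 h
        have := (τ.2 j).isLt
        simp only [Fin.val_natAdd, Fin.val_castAdd] at h1
        omega
      · rw [hr', hr', dsum_natAdd, dsum_natAdd, ← hf.2]
        exact Nat.add_lt_add_iff_left
    · change Fin (τ.1 + ρ.1) at i
      refine Fin.addCases (fun i => ?_) (fun i => ?_) i
      · rw [hl']
        obtain ⟨h1, h2, h3, h4⟩ := hgR i
        exact ⟨hxyR.1.trans h1, hxyR.2.trans h3⟩
      · rw [hr']
        have h1 := hthick.1
        have h2 := hthick.2
        obtain ⟨h5, h6⟩ := hfR i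
        omega

/-! ### Classes with long increasing sequences of non-oscillations -/

/-- `R` contains an occurrence of a simple permutation that is not contained in an oscillation. -/
def BadIn (π : FinPerm) (R : Rect) : Prop :=
  ∃ σ, IsSimple σ ∧ σ ∉ oscillationClass ∧ OccIn σ π R

lemma BadIn.reverse {π : FinPerm} {R : Rect} (h : BadIn π R) :
    BadIn (reverse π) (R.mirror π.1) := by
  obtain ⟨σ, h1, h2, h3⟩ := h
  refine ⟨PermPattern.reverse σ, h1.reverse, fun h => h2 ?_, h3.reverse⟩
  rw [← reverse_reverse σ]
  exact reverse_mem_oscillationClass h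

/-- Members of `C` contain `m` bad rectangles that form a chain for `r`. -/
def HasBadChain (r : Rect → Rect → Prop) (C : Set FinPerm) (m : ℕ) : Prop :=
  ∃ π ∈ C, ∃ s : Finset Rect, m ≤ s.card ∧ Rect.IsChain r s ∧
    ∀ R ∈ s, R.Thick ∧ R.x₂ ≤ π.1 ∧ BadIn π R

lemma HasBadChain.anti {r : Rect → Rect → Prop} {C : Set FinPerm} {m m' : ℕ}
    (h : HasBadChain r C m) (hm : m' ≤ m) : HasBadChain r C m' := by
  obtain ⟨π, hπ, s, h1, h2⟩ := h
  exact ⟨π, hπ, s, hm.trans h1, h2⟩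

lemma HasBadChain.reverse {C : Set FinPerm} {m : ℕ} (h : HasBadChain Rect.Down C m) :
    HasBadChain Rect.Up {π | reverse π ∈ C} m := by
  classical
  obtain ⟨π, hπ, s, h1, h2, h3⟩ := h
  have hinj : Set.InjOn (Rect.mirror π.1) (s : Set Rect) := by
    intro R hR S hS h
    obtain ⟨⟨a1, -⟩, b1, -⟩ := h3 R hR
    obtain ⟨⟨a2, -⟩, b2, -⟩ := h3 S hS
    simp only [Rect.mirror, Rect.mk.injEq] at h
    ext <;> omega
  refine ⟨PermPattern.reverse π, by simpa using hπ, s.image (Rect.mirror π.1),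
    by rwa [Finset.card_image_of_injOn hinj], ?_, ?_⟩
  · intro A hA B hB hne
    obtain ⟨R, hR, rfl⟩ := Finset.mem_image.1 hA
    obtain ⟨S, hS, rfl⟩ := Finset.mem_image.1 hB
    have hRS : R ≠ S := by rintro rfl; exact hne rfl
    rcases h2 R hR S hS hRS with ⟨a, b⟩ | ⟨a, b⟩
    · exact Or.inr ⟨Nat.sub_le_sub_left a _, b⟩
    · exact Or.inl ⟨Nat.sub_le_sub_left a _, b⟩
  · intro A hA
    obtain ⟨R, hR, rfl⟩ := Finset.mem_image.1 hA
    obtain ⟨⟨a1, a2⟩, b, c⟩ := h3 R hR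
    refine ⟨⟨?_, a2⟩, Nat.sub_le _ _, c.reverse⟩
    change π.1 - R.x₂ + 2 ≤ π.1 - R.x₁
    omega

lemma isPermClass_reverse {C : Set FinPerm} (h : IsPermClass C) :
    IsPermClass {π | reverse π ∈ C} :=
  fun π hπ _ hσ => h (reverse π) hπ _ hσ.reverse

lemma lowerGrowthRate_reverse (C : Set FinPerm) :
    lowerGrowthRate {π | reverse π ∈ C} = lowerGrowthRate C := by
  have : speed {π | reverse π ∈ C} = speed C := by
    funext n
    refine Set.ncard_congr (fun σ _ => Fin.revPerm.trans σ) (fun σ h => h) ?_ fun σ h => ?_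
    · intro σ τ _ _ h
      ext i
      have := congrArg (fun e : Equiv.Perm (Fin n) => e i.rev) h
      simpa using congrArg Fin.val this
    · refine ⟨Fin.revPerm.trans σ, ?_, ?_⟩
      · change (⟨n, Fin.revPerm.trans (Fin.revPerm.trans σ)⟩ : FinPerm) ∈ C
        have : Fin.revPerm.trans (Fin.revPerm.trans σ) = σ := by ext i; simp
        rwa [this]
      · ext i; simp
  unfold lowerGrowthRate
  rw [this]

/-- A statement that holds for all `m` for varying members of a finite set holds for all `m` for a
single one, if it becomes stronger as `m` grows. -/
lemma exists_forall_of_forall_exists {α : Type*} (T : Finset α) (Q : ℕ → α → Prop)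
    (hQ : ∀ a m m', m' ≤ m → Q m a → Q m' a) (h : ∀ m, ∃ a ∈ T, Q m a) :
    ∃ a ∈ T, ∀ m, Q m a := by
  by_contra! hc
  have : ∀ a, ∃ m, a ∈ T → ¬ Q m a := fun a => by
    by_cases ha : a ∈ T
    · obtain ⟨m, hm⟩ := hc a ha
      exact ⟨m, fun _ => hm⟩
    · exact ⟨0, fun h => absurd h ha⟩
  choose M hM using this
  -- At the supremum of the finitely many thresholds no member of `T` is left.
  obtain ⟨a, ha, hQa⟩ := h (T.sup M)
  exact hM a ha (hQ a _ _ (Finset.le_sup ha) hQa)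

/-- Two pigeonhole arguments: within a chain many rectangles share one set `K` of indecomposables,
and one `K` serves for chains of all lengths. All sums of members of `K` then belong to `C`. -/
theorem le_lowerGrowthRate_of_hasBadChain {t : ℝ} (ht : 0.4456 ≤ t) (ht1 : t ≤ 1)
    (he : t + t ^ 2 + 2 * t ^ 3 + 3 * t ^ 4 + 3 * t ^ 5 + t ^ 6 = 1) {C : Set FinPerm}
    (hC : IsPermClass C) (h : ∀ m, HasBadChain Rect.Up C m) :
    ENNReal.ofReal t⁻¹ ≤ lowerGrowthRate C := by
  classical
  have hfin : {τ : FinPerm | τ.1 ≤ 6}.Finite := by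
    refine (Set.finite_range fun x : Σ n : Fin 7, Equiv.Perm (Fin n) =>
      (⟨x.1, x.2⟩ : FinPerm)).subset ?_
    rintro ⟨n, p⟩ hn
    exact ⟨⟨⟨n, Nat.lt_succ_of_le hn⟩, p⟩, rfl⟩
  set U := hfin.toFinset with hU
  have hQ : ∀ m, ∃ K ∈ U.powerset, ∃ π ∈ C, ∃ s : Finset Rect, m ≤ s.card ∧
      Rect.IsChain Rect.Up s ∧ (∀ R ∈ s, R.Thick) ∧ (∀ R ∈ s, ∀ τ ∈ K, OccIn τ π R) ∧
      (p1 ∈ K ∧ (∀ τ ∈ K, 0 < τ.1 ∧ τ.1 ≤ 6 ∧ Indec τ) ∧ 1 ≤ ∑ τ ∈ K, t ^ τ.1) := by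
    intro m
    -- With `m + 1` instead of `m` the popular fibre is nonempty also for `m = 0`, so the properties
    -- of its `K` can be read off from a member.
    obtain ⟨π, hπ, s, h1, h2, h3⟩ := h (U.powerset.card * (m + 1))
    have hK : ∀ R, ∃ K ∈ U.powerset, R ∈ s → (∀ τ ∈ K, OccIn τ π R) ∧
        (p1 ∈ K ∧ (∀ τ ∈ K, 0 < τ.1 ∧ τ.1 ≤ 6 ∧ Indec τ) ∧ 1 ≤ ∑ τ ∈ K, t ^ τ.1) := by
      intro R
      by_cases hR : R ∈ s
      swap
      · exact ⟨∅, Finset.empty_mem_powerset _, fun h => absurd h hR⟩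
      obtain ⟨-, -, σ, hσ, hσO, hσR⟩ := h3 R hR
      obtain ⟨l, hl1, hl2, hl3, hl4⟩ := hσ.rich ht he hσO
      refine ⟨l.toFinset, ?_, fun _ => ⟨fun τ hτ => ?_, List.mem_toFinset.2 hl1, fun τ hτ => ?_, ?_⟩⟩
      · refine Finset.mem_powerset.2 fun τ hτ => ?_
        rw [hU, Set.Finite.mem_toFinset]
        exact (hl3 τ (List.mem_toFinset.1 hτ)).2.1
      · exact hσR.mono (hl3 τ (List.mem_toFinset.1 hτ)).2.2.2
      · obtain ⟨a, b, c, -⟩ := hl3 τ (List.mem_toFinset.1 hτ)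
        exact ⟨a, b, c⟩
      · rwa [List.sum_toFinset _ hl2]
    choose K hKU hK using hK
    obtain ⟨L, hL, hLm⟩ := Finset.exists_le_card_fiber_of_mul_le_card_of_maps_to
      (f := K) (s := s) (t := U.powerset) (n := m + 1) (fun R _ => hKU R)
      ⟨∅, Finset.empty_mem_powerset _⟩ h1
    have hmem : ∀ R ∈ s.filter (fun R => K R = L), R ∈ s ∧ K R = L :=
      fun R hR => Finset.mem_filter.1 hR
    obtain ⟨R, hR⟩ := Finset.card_pos.1 (show 0 < (s.filter fun R => K R = L).card by omega)
    refine ⟨L, hL, π, hπ, s.filter fun R => K R = L, by omega, h2.mono (Finset.filter_subset _ _),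
      fun R hR => (h3 R (hmem R hR).1).1, fun R hR τ hτ => ?_, ?_⟩
    · exact (hK R (hmem R hR).1).1 τ ((hmem R hR).2 ▸ hτ)
    · obtain ⟨hRs, rfl⟩ := hmem R hR
      exact (hK R hRs).2
  obtain ⟨K, -, hK⟩ := exists_forall_of_forall_exists U.powerset _ (by
    rintro K m m' hm ⟨π, hπ, s, h1, h2⟩
    exact ⟨π, hπ, s, hm.trans h1, h2⟩) hQ
  obtain ⟨-, -, -, -, -, -, -, hp1, hprop, hsum⟩ := hK 0
  have ht0 : 0 < t := by linarith
  refine le_lowerGrowthRate ht0 fun n => ?_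
  have hsums : ∀ ρ, SumOf K.toList ρ → ρ ∈ C := by
    intro ρ hρ
    obtain ⟨π, hπ, s, h1, h2, h3, h4, -⟩ := hK ρ.1
    obtain ⟨f, hf, -⟩ := hρ.occ_of_isChain (π := π)
      (fun τ hτ => (hprop τ (Finset.mem_toList.1 hτ)).1) s 0 0 h3 h2
      (fun R _ => ⟨Nat.zero_le _, Nat.zero_le _⟩) h1
      fun R hR τ hτ => h4 R hR τ (Finset.mem_toList.1 hτ)
    exact hC π hπ ρ hf.contained
  have h1 := pow_le_numSums ht0 ht1 (l := K.toList) (Finset.mem_toList.2 hp1) K.nodup_toList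
    (fun τ hτ => hprop τ (Finset.mem_toList.1 hτ)) (by rwa [Finset.sum_map_toList]) n
  have h2 : (numSums K.toList n : ℝ) ≤ speed C n := by
    exact_mod_cast numSums_le_speed hsums n
  exact h1.trans (by gcongr)

/-! ### Griddability -/

/-- At most `g` lines, with `0` and `n` added, form a division of `[0, n)`. -/
lemma exists_division (V : List ℕ) (g n : ℕ) (hV : V.length ≤ g) :
    ∃ c : Fin (g + 1 + 1) → ℕ, Monotone c ∧ c 0 = 0 ∧ c (Fin.last (g + 1)) = n ∧
      ∀ v ∈ V, ∀ k : Fin (g + 1), ¬ (c k.castSucc < v ∧ v < c k.succ) := by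
  -- Unused slots are filled with 0 and lines beyond `n` are clipped to `n`. Neither matters, since
  -- a line strictly inside a cell is at most `n`. Sorting yields the division.
  set w : Fin (g + 1 + 1) → ℕ := fun i =>
    if i = 0 then 0 else if i = Fin.last (g + 1) then n else min n (V.getD (i - 1) 0) with hw
  have hwn : ∀ i, w i ≤ n := fun i => by
    simp only [hw]; split_ifs <;> omega
  have hm : Monotone (w ∘ Tuple.sort w) := Tuple.monotone_sort w
  have hsurj : ∀ i, ∃ j, (w ∘ Tuple.sort w) j = w i := fun i =>
    ⟨(Tuple.sort w).symm i, by simp⟩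
  have hlast : (w ∘ Tuple.sort w) (Fin.last (g + 1)) = n := by
    obtain ⟨j, hj⟩ := hsurj (Fin.last (g + 1))
    have h1 : w (Fin.last (g + 1)) = n := by simp [hw, Fin.last_eq_zero_iff]
    exact le_antisymm (hwn _) (by rw [← h1, ← hj]; exact hm (Fin.le_last j))
  refine ⟨w ∘ Tuple.sort w, hm, ?_, hlast, fun v hv k hk => ?_⟩
  · obtain ⟨j, hj⟩ := hsurj 0
    have h1 : w 0 = 0 := by simp [hw]
    have h2 := hm (Fin.zero_le j)
    omega
  · obtain ⟨i, hi, rfl⟩ := List.mem_iff_getElem.1 hv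
    have hvn : V[i] ≤ n := by
      have := hm (Fin.le_last k.succ)
      omega
    have hi' : i + 1 < g + 1 + 1 := by omega
    obtain ⟨j, hj⟩ := hsurj ⟨i + 1, hi'⟩
    have h1 : w ⟨i + 1, hi'⟩ = V[i] := by
      simp only [hw]
      rw [if_neg (by simp [Fin.ext_iff]), if_neg (by simp [Fin.ext_iff]; omega)]
      simp [hi, hvn]
    rw [h1] at hj
    rw [← hj] at hk
    have h2 : k.castSucc < j := not_le.1 fun h => absurd (hm h) (not_le.2 hk.1)
    have h3 : j < k.succ := not_le.1 fun h => absurd (hm h) (not_le.2 hk.2)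
    have h4 := Fin.lt_def.1 h2
    have h5 := Fin.lt_def.1 h3
    simp at h4 h5
    omega

lemma mem_oscillationClass_of_length_le_one {σ : FinPerm} (h : σ.1 ≤ 1) :
    σ ∈ oscillationClass := by
  obtain ⟨n, p⟩ := σ
  change n ≤ 1 at h
  exact mem_oscillationClass_of_oscSeq id (fun i j h _ => h) fun i j hij => by
    have : i = j := by omega
    exact absurd hij (by rw [this]; exact lt_irrefl _)

lemma IsPatternAt.length_le_one {σ π : FinPerm} {S : Set (Fin π.1)} (h : IsPatternAt σ π S)
    (hS : S.Subsingleton) : σ.1 ≤ 1 := by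
  obtain ⟨f, rfl, -⟩ := h
  by_contra hc
  have := f.injective (hS (Set.mem_range_self ⟨0, by omega⟩) (Set.mem_range_self ⟨1, by omega⟩))
  simp at this

/-- A class that is not griddable contains long increasing or decreasing sequences of bad
rectangles. -/
theorem hasBadChain_of_not_isGriddable {C : Set FinPerm}
    (h : ¬ IsGriddable (wreathClosure oscillationClass) C) (m : ℕ) :
    HasBadChain Rect.Up C m ∨ HasBadChain Rect.Down C m := by
  set F : FinPerm → Set Rect := fun π => {R | R.Thick ∧ R.x₂ ≤ π.1 ∧ BadIn π R} with hF
  -- Otherwise `g` vertical and `g` horizontal lines suffice for every member of `C`, with `g`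
  -- depending on `m` only, and they yield a gridding by one matrix of fixed size.
  have hex : ∃ π ∈ C, Rect.HasIndep (F π) (m * m + 1) := by
    by_contra! hc
    obtain ⟨g, hg⟩ := Rect.exists_lines (m * m)
    refine h ⟨g + 1, g + 1, fun _ _ => wreathClosure oscillationClass,
      fun _ _ => ⟨isPermClass_wreathClosure _, subset_rfl⟩, fun π hπ => ?_⟩
    obtain ⟨V, H, hV, hH, hVH⟩ := hg (F π) π.1 (fun R hR => hR.1) (fun R hR => hR.2.1) (hc π hπ)
    obtain ⟨c, hc1, hc2, hc3, hc4⟩ := exists_division V g π.1 hV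
    obtain ⟨r, hr1, hr2, hr3, hr4⟩ := exists_division H g π.1 hH
    refine ⟨c, r, hc1, hc2, hc3, hr1, hr2, hr3, fun k l => Or.inr ?_⟩
    obtain ⟨σ, hσ⟩ := exists_pattern π
      (cell π (c k.castSucc) (c k.succ) (r l.castSucc) (r l.succ))
    refine ⟨σ, ?_, hσ⟩
    by_contra hσD
    obtain ⟨τ, h1, h2, h3⟩ := exists_isSimple_of_notMem_wreathClosure _ σ rfl hσD
    -- A cell of width or height at most one holds at most one entry and is harmless. A cell with
    -- content outside 𝓦(𝓞) is therefore thick, hence bad, yet no line cuts it.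
    have hlen : ¬ σ.1 ≤ 1 := fun h =>
      hσD (subset_wreathClosure _ (mem_oscillationClass_of_length_le_one h))
    have hRF : (⟨c k.castSucc, c k.succ, r l.castSucc, r l.succ⟩ : Rect) ∈ F π := by
      refine ⟨⟨?_, ?_⟩, ?_, τ, h1, h2, OccIn.mono (IsPatternAt.occIn hσ) h3⟩
      · by_contra hlt
        refine hlen (hσ.length_le_one ?_)
        rintro a ⟨a1, a2, -⟩ b ⟨b1, b2, -⟩
        simp only at hlt
        omega
      · by_contra hlt
        refine hlen (hσ.length_le_one ?_)
        rintro a ⟨-, -, a1, a2⟩ b ⟨-, -, b1, b2⟩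
        simp only at hlt
        exact π.2.injective (Fin.ext (by omega))
      · exact hc3 ▸ hc1 (Fin.le_last k.succ)
    rcases hVH _ hRF with ⟨v, hv, hvc⟩ | ⟨v, hv, hvc⟩
    · exact hc4 v hv k hvc
    · exact hr4 v hv l hvc
  obtain ⟨π, hπ, s, hs1, hs2, hs3⟩ := hex
  rcases Rect.exists_chain m m s (fun R hR => (hs2 R hR).1) hs3 (by omega) with
    ⟨u, hus, hm, hu⟩ | ⟨u, hus, hm, hu⟩
  · exact Or.inl ⟨π, hπ, u, hm.le, hu, fun R hR => hs2 R (hus hR)⟩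
  · exact Or.inr ⟨π, hπ, u, hm.le, hu, fun R hR => hs2 R (hus hR)⟩

theorem le_lowerGrowthRate_of_not_isGriddable {t : ℝ} (ht : 0.4456 ≤ t) (ht1 : t ≤ 1)
    (he : t + t ^ 2 + 2 * t ^ 3 + 3 * t ^ 4 + 3 * t ^ 5 + t ^ 6 = 1) {C : Set FinPerm}
    (hC : IsPermClass C) (h : ¬ IsGriddable (wreathClosure oscillationClass) C) :
    ENNReal.ofReal t⁻¹ ≤ lowerGrowthRate C := by
  by_cases hup : ∀ m, HasBadChain Rect.Up C m
  · exact le_lowerGrowthRate_of_hasBadChain ht ht1 he hC hup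
  · obtain ⟨m₀, hm₀⟩ := not_forall.1 hup
    rw [← lowerGrowthRate_reverse]
    refine le_lowerGrowthRate_of_hasBadChain ht ht1 he (isPermClass_reverse hC) fun m => ?_
    -- Increasing chains of length `m₀` do not exist, so from there on the chains are decreasing.
    rcases hasBadChain_of_not_isGriddable h (max m m₀) with h1 | h1
    · exact absurd (h1.anti (le_max_right _ _)) hm₀
    · exact (h1.anti (le_max_left _ _)).reverse

/-! ### The growth rate `γ` -/

/-- Divided by x⁶, the polynomial is strictly decreasing on the positive reals: for r > 1 its value
at `r * x` is less than r⁶ times its value at `x`. -/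
lemma unique_root {x y : ℝ} (hx : 0 < x) (hxy : x < y)
    (h : 1 + 3 * x + 3 * x ^ 2 + 2 * x ^ 3 + x ^ 4 + x ^ 5 - x ^ 6 = 0) :
    1 + 3 * y + 3 * y ^ 2 + 2 * y ^ 3 + y ^ 4 + y ^ 5 - y ^ 6 < 0 := by
  have hy : 0 < y := hx.trans hxy
  obtain ⟨r, hr, rfl⟩ : ∃ r, 1 < r ∧ y = r * x :=
    ⟨y / x, (one_lt_div hx).2 hxy, by field_simp⟩
  have hr0 : 0 < r := by linarith
  have hpow : ∀ k : ℕ, k < 6 → r ^ k < r ^ 6 := fun k hk => pow_lt_pow_right₀ hr hk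
  have h0 := hpow 0 (by norm_num)
  have h1 := mul_lt_mul_of_pos_right (hpow 1 (by norm_num)) (show 0 < 3 * x by positivity)
  have h2 := mul_lt_mul_of_pos_right (hpow 2 (by norm_num)) (show 0 < 3 * x ^ 2 by positivity)
  have h3 := mul_lt_mul_of_pos_right (hpow 3 (by norm_num)) (show 0 < 2 * x ^ 3 by positivity)
  have h4 := mul_lt_mul_of_pos_right (hpow 4 (by norm_num)) (show 0 < x ^ 4 by positivity)
  have h5 := mul_lt_mul_of_pos_right (hpow 5 (by norm_num)) (show 0 < x ^ 5 by positivity)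
  have h6 : r ^ 6 * (1 + 3 * x + 3 * x ^ 2 + 2 * x ^ 3 + x ^ 4 + x ^ 5 - x ^ 6) = 0 := by
    rw [h, mul_zero]
  ring_nf at h0 h1 h2 h3 h4 h5 h6 ⊢
  linarith

end PermPattern

theorem mainTheorem11 :
    ∃ γ : ℝ, 0 < γ ∧
      1 + 3 * γ + 3 * γ ^ 2 + 2 * γ ^ 3 + γ ^ 4 + γ ^ 5 - γ ^ 6 = 0 ∧
      (∀ x : ℝ, 0 < x →
        1 + 3 * x + 3 * x ^ 2 + 2 * x ^ 3 + x ^ 4 + x ^ 5 - x ^ 6 = 0 → x = γ) ∧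
      |γ - 2.24409| < 0.000005 ∧
      ∀ C : Set PermPattern.FinPerm, PermPattern.IsPermClass C →
        PermPattern.lowerGrowthRate C < ENNReal.ofReal γ →
        PermPattern.IsGriddable
          (PermPattern.wreathClosure PermPattern.oscillationClass) C := by
  -- The polynomial changes sign on this interval, whose endpoints differ from 2.24409 by 4·10⁻⁶.
  have hcont : ContinuousOn (fun x : ℝ =>
      1 + 3 * x + 3 * x ^ 2 + 2 * x ^ 3 + x ^ 4 + x ^ 5 - x ^ 6) (Set.Icc 2.244086 2.244094) := by
    fun_prop
  obtain ⟨γ, ⟨hγ1, hγ2⟩, hγ⟩ := intermediate_value_Icc' (by norm_num) hcont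
    (show (0 : ℝ) ∈ Set.Icc _ _ from ⟨by norm_num, by norm_num⟩)
  simp only at hγ
  have hpos : 0 < γ := by linarith
  refine ⟨γ, hpos, hγ, fun x hx hx0 => ?_, ?_, fun C hC hlow => ?_⟩
  · rcases lt_trichotomy x γ with h | h | h
    · exact absurd hγ (PermPattern.unique_root hx h hx0).ne
    · exact h
    · exact absurd hx0 (PermPattern.unique_root hpos h hγ).ne
  · rw [abs_lt]
    constructor <;> linarith
  · by_contra hgrid
    refine absurd hlow (not_lt.2 ?_)
    have h1 : (0.4456 : ℝ) ≤ γ⁻¹ := by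
      rw [le_inv_comm₀ (by norm_num) hpos]
      refine hγ2.trans (by norm_num)
    have h2 : γ⁻¹ ≤ 1 := inv_le_one_of_one_le₀ (by linarith)
    -- This is the equation of γ divided by γ⁶.
    have h3 : γ⁻¹ + γ⁻¹ ^ 2 + 2 * γ⁻¹ ^ 3 + 3 * γ⁻¹ ^ 4 + 3 * γ⁻¹ ^ 5 + γ⁻¹ ^ 6 = 1 := by
      field_simp
      linarith
    have h4 := PermPattern.le_lowerGrowthRate_of_not_isGriddable h1 h2 h3 hC hgrid
    rwa [inv_inv] at h4
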